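/- Let $d\ge 2$ be an integer and $p\ge 2$ a real number. Let $\xi_1,\xi_2,\dots$ be independent random vectors uniform on the unit Euclidean sphere $S^{d-1}\subset\mathbb{R}^d$, and let $Z$ be a Gaussian random vector in $\mathbb{R}^d$ with mean $0$ and covariance $\frac1d I_d$; $|\cdot|$ is the Euclidean norm. Put $$c_{p,d}=\frac{(p+d-2)(p+d-4)}{24\,d^2(d+2)}\cdot\begin{cases}3p(p-2), & 2\le p\le 4,\\ 1, & p>4.\end{cases}$$ (i) For every $n\ge 1$ and all real $a_1,\dots,a_n$ with $\sum_{j=1}^n a_j^2=1$, both moments below are finite and $$\mathbb{E}\Big|\sum_{j=1}^n a_j\xi_j\Big|^p\le \mathbb{E}|Z|^p-c_{p,d}\sum_{j=1}^n a_j^4 .$$ (ii) The order in $d$ of this constant is $1/d$ and is best possible: for each fixed $p>2$, $c_{p,d}=\Theta_p(1/d)$ as $d\to\infty$; and for each fixed $p\ge2$ there is a constant $K_p$, depending only on $p$, such that whenever $d\ge2$ and a real number $c$ satisfies $\mathbb{E}|\sum_{j=1}^n a_j\xi_j|^p\le \mathbb{E}|Z|^p-c\sum_{j=1}^n a_j^4$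 for all $n\ge1$ and all real $a_1,\dots,a_n$ with $\sum_{j=1}^n a_j^2=1$, then $c\le K_p/d$. -/

import Mathlib

open MeasureTheory ProbabilityTheory
open scoped Asymptotics

universe u

noncomputable section

/-- The uniform probability measure on the unit sphere of `ℝ^d`, as a measure on `ℝ^d`:
the surface measure of the sphere, normalised to total mass one. -/
def uniformSphere (d : ℕ) : Measure (EuclideanSpace ℝ (Fin d)) :=
  (((volume : Measure (EuclideanSpace ℝ (Fin d))).toSphere Set.univ)⁻¹ •
    (volume : Measure (EuclideanSpace ℝ (Fin d))).toSphere).map Subtype.val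

/-- The Gaussian measure on `ℝ^d` with mean `0` and covariance matrix `I_d / d`. -/
def gaussianNormalized (d : ℕ) : Measure (EuclideanSpace ℝ (Fin d)) :=
  multivariateGaussian 0 ((1 / (d : ℝ)) • (1 : Matrix (Fin d) (Fin d) ℝ))

/-- The constant `c_{p,d}`. -/
def deficitConst (p : ℝ) (d : ℕ) : ℝ :=
  (p + d - 2) * (p + d - 4) / (24 * (d : ℝ) ^ 2 * (d + 2)) *
    (if p ≤ 4 then 3 * p * (p - 2) else 1)

/-- `c` is an admissible deficit constant for the exponent `p` and the dimension `d`: for all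
independent random vectors `ξ₁, …, ξₙ` uniform on the unit sphere of `ℝ^d`, every Gaussian random
vector `Z` in `ℝ^d` with mean `0` and covariance `I_d / d`, and all real `a₁, …, aₙ` with
`∑ aⱼ² = 1`, both moments are finite and `E|∑ aⱼ ξⱼ|^p ≤ E|Z|^p - c ∑ aⱼ⁴`. -/
def IsDeficitConstant (p : ℝ) (d : ℕ) (c : ℝ) : Prop :=
  ∀ (Ω Ω' : Type u) [MeasurableSpace Ω] [MeasurableSpace Ω']
    (P : Measure Ω) [IsProbabilityMeasure P] (P' : Measure Ω') [IsProbabilityMeasure P']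
    (n : ℕ) (ξ : Fin n → Ω → EuclideanSpace ℝ (Fin d)) (Z : Ω' → EuclideanSpace ℝ (Fin d)),
    (∀ j, HasLaw (ξ j) (uniformSphere d) P) → iIndepFun ξ P →
    HasLaw Z (gaussianNormalized d) P' →
    ∀ a : Fin n → ℝ, ∑ j, a j ^ 2 = 1 →
      Integrable (fun ω => ‖∑ j, a j • ξ j ω‖ ^ p) P ∧
      Integrable (fun ω => ‖Z ω‖ ^ p) P' ∧
      ∫ ω, ‖∑ j, a j • ξ j ω‖ ^ p ∂P ≤ ∫ ω, ‖Z ω‖ ^ p ∂P' - c * ∑ j, a j ^ 4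

end

/-! Write p = 2q. The spherical summands aξ are replaced by Gaussian ones aG one at a time. With the
rest of the sum frozen at x, put ψ(t) = E‖x + √t ξ‖^(2q). The direction of G is uniform and
independent of ‖G‖, so E‖x + aG‖^(2q) = E ψ(a²‖G‖²), and E‖G‖² = 1. If ψ is convex, Jensen's
inequality says that the exchange increases the moment. To measure the increase, subtract from ψ a
polynomial of degree at most 4 in ‖x‖² + t (`quarticAux`) that leaves a convex function; the
exchange then gains at least the Jensen gap of that polynomial, which is governed by Var(a²‖G‖²) =
2a⁴/d. Averaging over x uses only symmetry-type data: the second moment and E‖x‖⁴ ≤ 3(E‖x‖²)², both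
stable under convolution (`IsHybridLaw`). The result is `IsSphereMarginal.exchange`, and summing
over the exchanges gives c ∑ aⱼ⁴.

The analytic core is a lower bound for ψ''. Let U be the cosine of the angle between x and ξ and k =
‖x + √t ξ‖² + e, where e > 0 avoids singularities. Rotation invariance gives (d-1) E[U g(U)] =
E[(1-U²) g'(U)], which yields recursions between the moments E[U^j k^σ]. For q ≥ 2 they exhibit ψ''
- q(q-1) E k^(q-2) as nonnegative (`le_sphMomentDeriv2_of_two_le`). For 1 ≤ q ≤ 2 the power k^(q-2)
is singular, and the radial Laplace equation with integrating factor t^(d/2) is used twice: Jensen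
for exponent q-2 bounds the first derivative for exponent q-1, which bounds the second derivative
for exponent q (`le_sphMomentDeriv2_of_le_two`). The limit e → 0 is taken in the convexity
inequality itself (`convexOn_sphMoment_sub`).

For the optimality of 1/d it suffices to test n = 1: then c ≤ E‖Z‖^p - 1, and an even moment of Z
dominating the p-th is an explicit product within O(1/d) of 1. -/

section

open Set Filter Topology

noncomputable section

/-! ### Invariance of the uniform measure and integration by parts on the sphere -/

section UniformSphere

open scoped Pointwise

variable {d : ℕ}

lemma uniformSphere_apply {s : Set (EuclideanSpace ℝ (Fin d))} (hs : MeasurableSet s) :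
    uniformSphere d s = ((volume : Measure (EuclideanSpace ℝ (Fin d))).toSphere univ)⁻¹ *
      (Module.finrank ℝ (EuclideanSpace ℝ (Fin d)) *
        volume (Ioo (0 : ℝ) 1 • (s ∩ Metric.sphere 0 1) : Set (EuclideanSpace ℝ (Fin d)))) := by
  rw [uniformSphere, Measure.map_apply measurable_subtype_coe hs, Measure.smul_apply,
    Measure.toSphere_apply' _ (measurable_subtype_coe hs), smul_eq_mul,
    Subtype.image_preimage_coe, inter_comm]

/-- The mass of a set is proportional to the volume of the cone over it; a linear isometry preserves
volume and carries cones to cones. -/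
lemma uniformSphere_map_isometry
    (L : EuclideanSpace ℝ (Fin d) ≃ₗᵢ[ℝ] EuclideanSpace ℝ (Fin d)) :
    (uniformSphere d).map L = uniformSphere d := by
  ext s hs
  rw [Measure.map_apply L.continuous.measurable hs,
    uniformSphere_apply (L.continuous.measurable hs), uniformSphere_apply hs]
  congr 2
  have h := L.measurePreserving.measure_preimage_emb L.toHomeomorph.measurableEmbedding
    (Ioo (0 : ℝ) 1 • (s ∩ Metric.sphere 0 1) : Set (EuclideanSpace ℝ (Fin d)))
  rw [← h]
  congr 1
  ext x
  constructor
  · rintro ⟨r, hr, y, ⟨hy, hy'⟩, rfl⟩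
    exact ⟨r, hr, L y, ⟨hy, by simpa using hy'⟩, by simp⟩
  · rintro ⟨r, hr, y, ⟨hy, hy'⟩, h⟩
    refine ⟨r, hr, L.symm y, ⟨by simpa using hy, by simpa using hy'⟩, ?_⟩
    apply L.injective
    simpa using h

lemma ae_norm_eq_one_uniformSphere : ∀ᵐ x ∂(uniformSphere d), ‖x‖ = 1 := by
  rw [uniformSphere, ae_map_iff measurable_subtype_coe.aemeasurable
    (measurableSet_eq_fun (by fun_prop) (by fun_prop))]
  exact Eventually.of_forall fun x => by simp

lemma isProbabilityMeasure_uniformSphere (hd : 1 ≤ d) :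
    IsProbabilityMeasure (uniformSphere d) := by
  have : Nonempty (Fin d) := ⟨⟨0, hd⟩⟩
  refine @Measure.isProbabilityMeasure_map _ _ _ _ _ ⟨?_⟩ _ measurable_subtype_coe.aemeasurable
  rw [Measure.smul_apply, smul_eq_mul]
  exact ENNReal.inv_mul_cancel (by
    rw [Ne, Measure.measure_univ_eq_zero]; exact Measure.toSphere_ne_zero _)
    (measure_ne_top _ _)

/-- A measure invariant under all linear isometries of the space. -/
def IsometryInvariant (μ : Measure (EuclideanSpace ℝ (Fin d))) : Prop :=
  ∀ L : EuclideanSpace ℝ (Fin d) ≃ₗᵢ[ℝ] EuclideanSpace ℝ (Fin d), μ.map L = μ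

lemma IsometryInvariant.integral_comp {μ : Measure (EuclideanSpace ℝ (Fin d))}
    (hμ : IsometryInvariant μ) (L : EuclideanSpace ℝ (Fin d) ≃ₗᵢ[ℝ] EuclideanSpace ℝ (Fin d))
    (f : EuclideanSpace ℝ (Fin d) → ℝ) : ∫ x, f (L x) ∂μ = ∫ x, f x ∂μ := by
  conv_rhs => rw [← hμ L]
  exact (integral_map_equiv L.toHomeomorph.toMeasurableEquiv f).symm

/-- This is the reflection in the hyperplane orthogonal to sin(φ/2) eᵢ - cos(φ/2) eⱼ. As φ varies,
the two coordinates of L x satisfy the differential equations of a rotation, which is all that the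
integration by parts needs. -/
lemma exists_plane_reflection {i j : Fin d} (hij : i ≠ j) (φ : ℝ) :
    ∃ L : EuclideanSpace ℝ (Fin d) ≃ₗᵢ[ℝ] EuclideanSpace ℝ (Fin d),
      ∀ x, L x i = Real.cos φ * x i + Real.sin φ * x j ∧
        L x j = Real.sin φ * x i - Real.cos φ * x j := by
  set w : EuclideanSpace ℝ (Fin d) := EuclideanSpace.single i (Real.sin (φ / 2)) -
    EuclideanSpace.single j (Real.cos (φ / 2)) with hw
  have hin : ∀ x : EuclideanSpace ℝ (Fin d),
      inner ℝ w x = Real.sin (φ / 2) * x i - Real.cos (φ / 2) * x j := by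
    intro x
    simp [hw, inner_sub_left, EuclideanSpace.inner_single_left]
  have hwi : w i = Real.sin (φ / 2) := by simp [hw, hij]
  have hwj : w j = -Real.cos (φ / 2) := by simp [hw, hij.symm]
  have hnorm : ‖w‖ ^ 2 = 1 := by
    rw [← real_inner_self_eq_norm_sq, hin, hwi, hwj]
    nlinarith [Real.sin_sq_add_cos_sq (φ / 2)]
  have h2 : φ = 2 * (φ / 2) := by ring
  refine ⟨(ℝ ∙ w)ᗮ.reflection, fun x => ?_⟩
  rw [Submodule.reflection_orthogonal_apply, Submodule.reflection_singleton_apply, hin]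
  have hs := Real.sin_sq_add_cos_sq (φ / 2)
  constructor
  · rw [h2, Real.cos_two_mul', Real.sin_two_mul]
    simp only [PiLp.neg_apply, PiLp.sub_apply, PiLp.smul_apply, hwi, RCLike.ofReal_real_eq_id, id,
      hnorm, smul_eq_mul, nsmul_eq_mul, ← h2]
    push_cast
    linear_combination (-x i) * hs
  · rw [h2, Real.cos_two_mul', Real.sin_two_mul]
    simp only [PiLp.neg_apply, PiLp.sub_apply, PiLp.smul_apply, hwj, RCLike.ofReal_real_eq_id, id,
      hnorm, smul_eq_mul, nsmul_eq_mul, ← h2]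
    push_cast
    linear_combination (-x j) * hs

lemma integrable_of_continuousOn_compact {X : Type*} [TopologicalSpace X] [T2Space X]
    [MeasurableSpace X] [OpensMeasurableSpace X]
    {μ : Measure X} [IsFiniteMeasure μ] {K : Set X} (hK : IsCompact K) (hμ : ∀ᵐ x ∂μ, x ∈ K)
    {f : X → ℝ} (hf : ContinuousOn f K) : Integrable f μ := by
  have h := hf.integrableOn_compact' hK hK.measurableSet (μ := μ)
  rwa [IntegrableOn, Measure.restrict_eq_self_of_ae_mem hμ] at h

/-- Integration by parts for an isometry invariant measure on the sphere, in a coordinate plane. -/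
lemma IsometryInvariant.integral_coord_mul {μ : Measure (EuclideanSpace ℝ (Fin d))}
    [IsProbabilityMeasure μ] (hμ : IsometryInvariant μ) (hμ1 : ∀ᵐ x ∂μ, ‖x‖ = 1)
    {i j : Fin d} (hij : i ≠ j) {g g' : ℝ → ℝ} (hg : ∀ u ∈ Icc (-1 : ℝ) 1, HasDerivAt g (g' u) u)
    (hg' : ContinuousOn g' (Icc (-1) 1)) :
    ∫ x, x i * g (x i) ∂μ = ∫ x, x j ^ 2 * g' (x i) ∂μ := by
  have hgc : ContinuousOn g (Icc (-1) 1) := fun u hu => (hg u hu).continuousAt.continuousWithinAt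
  have hK : IsCompact (Metric.closedBall (0 : EuclideanSpace ℝ (Fin d)) 1) :=
    isCompact_closedBall _ _
  have hKμ : ∀ᵐ x ∂μ, x ∈ Metric.closedBall (0 : EuclideanSpace ℝ (Fin d)) 1 := by
    filter_upwards [hμ1] with x hx
    simp [hx]
  choose L hL using fun φ => exists_plane_reflection hij φ
  have hmaps : ∀ φ x, x ∈ Metric.closedBall (0 : EuclideanSpace ℝ (Fin d)) 1 →
      L φ x i ∈ Icc (-1 : ℝ) 1 := by
    intro φ x hx
    refine abs_le.1 ?_
    rw [← Real.norm_eq_abs]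
    refine (PiLp.norm_apply_le _ _).trans ?_
    simpa using hx
  have hmaps0 : ∀ x, x ∈ Metric.closedBall (0 : EuclideanSpace ℝ (Fin d)) 1 →
      x i ∈ Icc (-1 : ℝ) 1 := by
    intro x hx
    refine abs_le.1 ?_
    rw [← Real.norm_eq_abs]
    refine (PiLp.norm_apply_le _ _).trans ?_
    simpa using hx
  have hcont1 : ∀ φ, ContinuousOn (fun x => L φ x j * g (L φ x i)) (Metric.closedBall 0 1) := by
    intro φ
    exact ContinuousOn.mul (by fun_prop)
      (hgc.comp (f := fun x => L φ x i) (by fun_prop) (fun x hx => hmaps φ x hx))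
  have hcont2 : ∀ φ, ContinuousOn (fun x => L φ x i * g (L φ x i) - L φ x j ^ 2 * g' (L φ x i))
      (Metric.closedBall 0 1) := by
    intro φ
    exact (ContinuousOn.mul (by fun_prop)
      (hgc.comp (f := fun x => L φ x i) (by fun_prop) (fun x hx => hmaps φ x hx))).sub
      (ContinuousOn.mul (by fun_prop)
      (hg'.comp (f := fun x => L φ x i) (by fun_prop) (fun x hx => hmaps φ x hx)))
  obtain ⟨C, hC⟩ := isCompact_Icc.exists_bound_of_continuousOn hgc
  obtain ⟨C', hC'⟩ := isCompact_Icc.exists_bound_of_continuousOn hg'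
  -- By invariance ∫ (Lx)ⱼ g((Lx)ᵢ) does not depend on φ. Its derivative at 0, which must vanish, is
  -- ∫ (Lx)ᵢ g((Lx)ᵢ) - (Lx)ⱼ² g'((Lx)ᵢ), and invariance removes L again.
  have key := hasDerivAt_integral_of_dominated_loc_of_deriv_le (μ := μ) (𝕜 := ℝ) (x₀ := 0)
    (s := univ) (bound := fun _ => C + C')
    (F := fun φ x => L φ x j * g (L φ x i))
    (F' := fun φ x => L φ x i * g (L φ x i) - L φ x j ^ 2 * g' (L φ x i)) univ_mem
    (Eventually.of_forall fun φ =>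
      (integrable_of_continuousOn_compact hK hKμ (hcont1 φ)).aestronglyMeasurable)
    (integrable_of_continuousOn_compact hK hKμ (hcont1 0))
    (integrable_of_continuousOn_compact hK hKμ (hcont2 0)).aestronglyMeasurable
    (by
      filter_upwards [hKμ] with x hx φ _
      have h1 := hC _ (hmaps φ x hx)
      have h2 := hC' _ (hmaps φ x hx)
      have h3 : |L φ x i| ≤ 1 := abs_le.2 (hmaps φ x hx)
      have h4 : |L φ x j| ≤ 1 := by
        rw [← Real.norm_eq_abs]
        refine (PiLp.norm_apply_le _ _).trans ?_
        simpa using hx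
      refine (norm_sub_le _ _).trans (add_le_add ?_ ?_)
      · rw [norm_mul]
        calc _ ≤ 1 * ‖g (L φ x i)‖ := by gcongr; exact h3
          _ ≤ C := by simpa using h1
      · rw [norm_mul]
        calc _ ≤ 1 * ‖g' (L φ x i)‖ := by
              gcongr
              rw [norm_pow]
              exact pow_le_one₀ (norm_nonneg _) h4
          _ ≤ C' := by simpa using h2)
    (integrable_const _)
    (by
      filter_upwards [hKμ] with x hx φ _
      have hi : HasDerivAt (fun φ => L φ x i) (-L φ x j) φ := by
        have : (fun φ => L φ x i) = fun φ => Real.cos φ * x i + Real.sin φ * x j :=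
          funext fun φ => (hL φ x).1
        rw [this, (hL φ x).2]
        exact (((Real.hasDerivAt_cos φ).mul_const (x i)).add
          ((Real.hasDerivAt_sin φ).mul_const (x j))).congr_deriv (by ring)
      have hj : HasDerivAt (fun φ => L φ x j) (L φ x i) φ := by
        have : (fun φ => L φ x j) = fun φ => Real.sin φ * x i - Real.cos φ * x j :=
          funext fun φ => (hL φ x).2
        rw [this, (hL φ x).1]
        exact (((Real.hasDerivAt_sin φ).mul_const (x i)).sub
          ((Real.hasDerivAt_cos φ).mul_const (x j))).congr_deriv (by ring)
      exact (hj.mul ((hg _ (hmaps φ x hx)).comp φ hi)).congr_deriv (by simp only [Function.comp]; ring))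
  have hconst : (fun φ => ∫ x, L φ x j * g (L φ x i) ∂μ) = fun _ => ∫ x, x j * g (x i) ∂μ :=
    funext fun φ => hμ.integral_comp (L φ) (fun x => x j * g (x i))
  have h0 := key.2
  rw [hconst] at h0
  have h1 := h0.unique (hasDerivAt_const _ _)
  rw [hμ.integral_comp (L 0) (fun x => x i * g (x i) - x j ^ 2 * g' (x i)), integral_sub] at h1
  · linarith
  · exact integrable_of_continuousOn_compact hK hKμ
      (ContinuousOn.mul (by fun_prop) (hgc.comp (f := fun x : EuclideanSpace ℝ (Fin d) => x i) (by fun_prop) hmaps0))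
  · exact integrable_of_continuousOn_compact hK hKμ
      (ContinuousOn.mul (by fun_prop) (hg'.comp (f := fun x : EuclideanSpace ℝ (Fin d) => x i) (by fun_prop) hmaps0))

/-- `lam` is the law of a linear functional of norm one under the uniform measure of the sphere. -/
structure IsSphereMarginal (d : ℕ) (lam : Measure ℝ) : Prop where
  isProbabilityMeasure : IsProbabilityMeasure lam
  ae_mem : ∀ᵐ u ∂lam, u ∈ Icc (-1 : ℝ) 1
  integral_id_mul : ∀ g g' : ℝ → ℝ, (∀ u ∈ Icc (-1 : ℝ) 1, HasDerivAt g (g' u) u) →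
    ContinuousOn g' (Icc (-1) 1) →
    ((d : ℝ) - 1) * ∫ u, u * g u ∂lam = ∫ u, (1 - u ^ 2) * g' u ∂lam
  map_inner : ∀ x : EuclideanSpace ℝ (Fin d),
    (uniformSphere d).map (fun ξ => inner ℝ x ξ) = lam.map (fun u => ‖x‖ * u)

lemma exists_isometry_map {x y : EuclideanSpace ℝ (Fin d)} (h : ‖x‖ = ‖y‖) :
    ∃ L : EuclideanSpace ℝ (Fin d) ≃ₗᵢ[ℝ] EuclideanSpace ℝ (Fin d), L x = y :=
  ⟨_, Submodule.reflection_sub h⟩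

/-- The law of one coordinate serves. Adding the plane identities over the d-1 other coordinates,
whose squares sum to 1 - xᵢ², gives the integration by parts; an isometry reduces a general
functional to this coordinate. -/
lemma exists_isSphereMarginal (hd : 2 ≤ d) : ∃ lam, IsSphereMarginal d lam := by
  have hprob := isProbabilityMeasure_uniformSphere (d := d) (by omega)
  have hinv : IsometryInvariant (uniformSphere d) := uniformSphere_map_isometry
  have h1 := ae_norm_eq_one_uniformSphere (d := d)
  let i : Fin d := ⟨0, by omega⟩
  have hm : Measurable (fun x : EuclideanSpace ℝ (Fin d) => (x i : ℝ)) := by fun_prop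
  have hK : IsCompact (Metric.closedBall (0 : EuclideanSpace ℝ (Fin d)) 1) :=
    isCompact_closedBall _ _
  have hKμ : ∀ᵐ x ∂(uniformSphere d), x ∈ Metric.closedBall (0 : EuclideanSpace ℝ (Fin d)) 1 := by
    filter_upwards [h1] with x hx
    simp [hx]
  have hmaps0 : ∀ x, x ∈ Metric.closedBall (0 : EuclideanSpace ℝ (Fin d)) 1 →
      x i ∈ Icc (-1 : ℝ) 1 := by
    intro x hx
    refine abs_le.1 ?_
    rw [← Real.norm_eq_abs]
    refine (PiLp.norm_apply_le _ _).trans ?_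
    simpa using hx
  have hmem : ∀ᵐ u ∂((uniformSphere d).map fun x => x i), u ∈ Icc (-1 : ℝ) 1 := by
    refine (ae_map_iff hm.aemeasurable measurableSet_Icc).2 ?_
    filter_upwards [hKμ] with x hx using hmaps0 x hx
  have hpm := Measure.isProbabilityMeasure_map (μ := uniformSphere d) hm.aemeasurable
  refine ⟨(uniformSphere d).map (fun x => x i), ⟨hpm, hmem, ?_, ?_⟩⟩
  · intro g g' hg hg'
    have hgc : ContinuousOn g (Icc (-1) 1) :=
      fun u hu => (hg u hu).continuousAt.continuousWithinAt
    rw [integral_map hm.aemeasurable (integrable_of_continuousOn_compact isCompact_Icc hmem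
      (by fun_prop)).aestronglyMeasurable,
      integral_map hm.aemeasurable (integrable_of_continuousOn_compact isCompact_Icc hmem
      (by fun_prop)).aestronglyMeasurable]
    have hsum : ∫ x, (1 - x i ^ 2) * g' (x i) ∂(uniformSphere d) =
        ∫ x, ∑ j ∈ Finset.univ.erase i, x j ^ 2 * g' (x i) ∂(uniformSphere d) := by
      refine integral_congr_ae ?_
      filter_upwards [h1] with x hx
      rw [← Finset.sum_mul]
      congr 1
      have := EuclideanSpace.real_norm_sq_eq x
      rw [hx, ← Finset.add_sum_erase _ _ (Finset.mem_univ i)] at this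
      linarith
    rw [hsum, integral_finsetSum _ fun j _ => integrable_of_continuousOn_compact
      (f := fun x => x j ^ 2 * g' (x i)) hK hKμ (ContinuousOn.mul (by fun_prop) (hg'.comp (f := fun x : EuclideanSpace ℝ (Fin d) => x i) (by fun_prop) hmaps0))]
    rw [Finset.sum_congr rfl fun j hj =>
      (hinv.integral_coord_mul h1 (Finset.ne_of_mem_erase hj).symm hg hg').symm]
    rw [Finset.sum_const, Finset.card_erase_of_mem (Finset.mem_univ _), Finset.card_univ,
      Fintype.card_fin, nsmul_eq_mul, Nat.cast_sub (by omega)]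
    simp
  · intro x
    obtain ⟨L, hL⟩ := exists_isometry_map (x := EuclideanSpace.single i ‖x‖) (y := x) (by simp)
    rw [Measure.map_map (by fun_prop) hm]
    conv_lhs => rw [← hinv L]
    rw [Measure.map_map (by fun_prop) L.continuous.measurable]
    congr 1
    ext ξ
    simp only [Function.comp]
    conv_lhs => rw [← hL]
    rw [L.inner_map_map, EuclideanSpace.inner_single_left]
    simp

end UniformSphere

/-! ### Regularised moments of ‖x + √t ξ‖, their recursions and derivatives -/

section SphereMoment

/-- `‖x + y‖² + e` in terms of `s = ‖x‖²`, `t = ‖y‖²` and the cosine `u` of the angle. -/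
def sphKernel (s e t u : ℝ) : ℝ := s + t + e + 2 * (√s * √t) * u

/-- Moments `E[U ^ j (‖x + √t ξ‖² + e) ^ σ]`, where `‖x‖² = s` and `U` is the cosine of the angle. -/
def sphMoment (lam : Measure ℝ) (s e : ℝ) (j : ℕ) (σ t : ℝ) : ℝ :=
  ∫ u, u ^ j * sphKernel s e t u ^ σ ∂lam

variable {d : ℕ} {lam : Measure ℝ} {s e t u σ : ℝ}

lemma le_sphKernel (hs : 0 ≤ s) (ht : 0 ≤ t) (hu : u ∈ Icc (-1 : ℝ) 1) : e ≤ sphKernel s e t u := by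
  have h1 := Real.sq_sqrt hs
  have h2 := Real.sq_sqrt ht
  have h3 := mul_nonneg (Real.sqrt_nonneg s) (Real.sqrt_nonneg t)
  unfold sphKernel
  nlinarith [hu.1, sq_nonneg (√s - √t)]

/-- The difference of the two sides is (√s u + √t)² + e. -/
lemma mul_one_sub_sq_le_sphKernel (hs : 0 ≤ s) (ht : 0 ≤ t) (he : 0 ≤ e) :
    s * (1 - u ^ 2) ≤ sphKernel s e t u := by
  have h1 := Real.sq_sqrt hs
  have h2 := Real.sq_sqrt ht
  unfold sphKernel
  nlinarith [sq_nonneg (√s * u + √t)]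

lemma continuous_sphKernel : Continuous fun p : ℝ × ℝ => sphKernel s e p.1 p.2 := by
  unfold sphKernel
  fun_prop

lemma continuousOn_sphMoment_integrand (hs : 0 ≤ s) (he : 0 < e) (j : ℕ) (σ : ℝ) :
    ContinuousOn (fun p : ℝ × ℝ => p.2 ^ j * sphKernel s e p.1 p.2 ^ σ)
      (Ici 0 ×ˢ Icc (-1) 1) := by
  refine ContinuousOn.mul (by fun_prop) (ContinuousOn.rpow_const
    continuous_sphKernel.continuousOn ?_)
  rintro ⟨t, u⟩ ⟨ht, hu⟩
  exact Or.inl (he.trans_le (le_sphKernel hs ht hu)).ne'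

lemma continuousOn_sphMoment_integrand_right (hs : 0 ≤ s) (he : 0 < e) (ht : 0 ≤ t) (j : ℕ) (σ : ℝ) :
    ContinuousOn (fun u : ℝ => u ^ j * sphKernel s e t u ^ σ) (Icc (-1) 1) :=
  (continuousOn_sphMoment_integrand hs he j σ).comp (f := fun u : ℝ => (t, u)) (by fun_prop)
    fun _ hu => ⟨ht, hu⟩

namespace IsSphereMarginal

lemma integrable_of_continuousOn (hlam : IsSphereMarginal d lam) {f : ℝ → ℝ}
    (hf : ContinuousOn f (Icc (-1) 1)) : Integrable f lam :=
  have := hlam.isProbabilityMeasure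
  integrable_of_continuousOn_compact isCompact_Icc hlam.ae_mem hf

lemma integrable_sphMoment (hlam : IsSphereMarginal d lam) (hs : 0 ≤ s) (he : 0 < e) (ht : 0 ≤ t)
    (j : ℕ) (σ : ℝ) : Integrable (fun u => u ^ j * sphKernel s e t u ^ σ) lam :=
  hlam.integrable_of_continuousOn (continuousOn_sphMoment_integrand_right hs he ht j σ)

lemma integral_id (hlam : IsSphereMarginal d lam) (hd : 2 ≤ d) : ∫ u, u ∂lam = 0 := by
  have h := hlam.integral_id_mul (fun _ => 1) (fun _ => 0) (fun u _ => hasDerivAt_const _ _)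
    continuousOn_const
  simp only [mul_one, mul_zero, integral_zero] at h
  have : (2 : ℝ) ≤ d := by exact_mod_cast hd
  rcases mul_eq_zero.1 h with h | h
  · linarith
  · exact h

lemma continuousOn_sphMoment (hlam : IsSphereMarginal d lam) (hs : 0 ≤ s) (he : 0 < e)
    (j : ℕ) (σ : ℝ) : ContinuousOn (sphMoment lam s e j σ) (Ici 0) := by
  have := hlam.isProbabilityMeasure
  intro t ht
  obtain ⟨C, hC⟩ := (isCompact_Icc.prod isCompact_Icc).exists_bound_of_continuousOn
    ((continuousOn_sphMoment_integrand hs he j σ).mono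
      (prod_mono (Icc_subset_Ici_self : Icc 0 (t + 1) ⊆ Ici 0) Subset.rfl))
  have hnear : ∀ᶠ t' in 𝓝[Ici 0] t, t' ∈ Icc 0 (t + 1) := by
    filter_upwards [self_mem_nhdsWithin, mem_nhdsWithin_of_mem_nhds (Iic_mem_nhds (lt_add_one t))]
      with t' h1 h2 using ⟨h1, h2⟩
  refine tendsto_integral_filter_of_dominated_convergence (fun _ => C) ?_ ?_
    (integrable_const _) ?_
  · filter_upwards [self_mem_nhdsWithin] with t' ht'
    exact (hlam.integrable_sphMoment hs he ht' j σ).aestronglyMeasurable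
  · filter_upwards [hnear] with t' ht'
    filter_upwards [hlam.ae_mem] with u hu
    exact hC (t', u) ⟨ht', hu⟩
  · filter_upwards [hlam.ae_mem] with u hu
    exact ((continuousOn_sphMoment_integrand hs he j σ).comp (f := fun t : ℝ => (t, u))
      (s := Ici 0) (by fun_prop) (fun t ht => ⟨ht, hu⟩)) t ht

lemma _root_.hasDerivAt_sphKernel (ht : 0 < t) :
    HasDerivAt (fun t => sphKernel s e t u) (1 + √s / √t * u) t := by
  unfold sphKernel
  have h := ((((hasDerivAt_id t).const_add s).add_const e).add
    ((((Real.hasDerivAt_sqrt ht.ne').const_mul (√s)).const_mul 2).mul_const u))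
  refine h.congr_deriv ?_
  have := Real.sqrt_pos.2 ht
  field_simp

lemma hasDerivAt_sphMoment (hlam : IsSphereMarginal d lam) (hs : 0 ≤ s) (he : 0 < e) (ht : 0 < t)
    (j : ℕ) (σ : ℝ) :
    HasDerivAt (sphMoment lam s e j σ) (σ * (sphMoment lam s e j (σ - 1) t +
      √s / √t * sphMoment lam s e (j + 1) (σ - 1) t)) t := by
  have := hlam.isProbabilityMeasure
  let F' : ℝ → ℝ → ℝ := fun t u => σ * (u ^ j * sphKernel s e t u ^ (σ - 1) +
    √s / √t * (u ^ (j + 1) * sphKernel s e t u ^ (σ - 1)))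
  have hsub : Icc (t / 2) (2 * t) ⊆ Ici 0 := fun x hx => (by linarith [hx.1] : (0 : ℝ) ≤ x)
  have hF'c : ContinuousOn (fun p : ℝ × ℝ => F' p.1 p.2) (Icc (t / 2) (2 * t) ×ˢ Icc (-1) 1) := by
    refine ContinuousOn.mul continuousOn_const (ContinuousOn.add ?_ (ContinuousOn.mul ?_ ?_))
    · exact (continuousOn_sphMoment_integrand hs he j _).mono (prod_mono hsub Subset.rfl)
    · refine ContinuousOn.div continuousOn_const (by fun_prop) ?_
      rintro ⟨x, y⟩ ⟨hx, -⟩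
      exact (Real.sqrt_pos.2 (by linarith [hx.1] : (0 : ℝ) < x)).ne'
    · exact (continuousOn_sphMoment_integrand hs he (j + 1) _).mono (prod_mono hsub Subset.rfl)
  obtain ⟨C, hC⟩ := (isCompact_Icc.prod isCompact_Icc).exists_bound_of_continuousOn hF'c
  have hnhds : Icc (t / 2) (2 * t) ∈ 𝓝 t := Icc_mem_nhds (by linarith) (by linarith)
  have key := hasDerivAt_integral_of_dominated_loc_of_deriv_le (μ := lam) (𝕜 := ℝ) (x₀ := t)
    (s := Icc (t / 2) (2 * t)) (bound := fun _ => C)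
    (F := fun t u => u ^ j * sphKernel s e t u ^ σ) (F' := F') hnhds
    (by
      filter_upwards [hnhds] with t' ht'
      exact (hlam.integrable_sphMoment hs he (hsub ht') j σ).aestronglyMeasurable)
    (hlam.integrable_sphMoment hs he ht.le j σ)
    (((hlam.integrable_sphMoment hs he ht.le j (σ - 1)).add
      ((hlam.integrable_sphMoment hs he ht.le (j + 1) (σ - 1)).const_mul _)).const_mul
        σ).aestronglyMeasurable
    (by
      filter_upwards [hlam.ae_mem] with u hu t' ht'
      exact hC (t', u) ⟨ht', hu⟩)
    (integrable_const _)
    (by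
      filter_upwards [hlam.ae_mem] with u hu t' ht'
      have ht0 : 0 < t' := by linarith [ht'.1]
      have hk := he.trans_le (le_sphKernel (e := e) hs ht0.le hu)
      refine (((hasDerivAt_sphKernel ht0).rpow_const (p := σ) (Or.inl hk.ne')).const_mul
        (u ^ j)).congr_deriv ?_
      simp only [F']
      ring)
  refine key.2.congr_deriv ?_
  simp only [F', sphMoment]
  rw [integral_const_mul, integral_add (hlam.integrable_sphMoment hs he ht.le j (σ - 1))
    ((hlam.integrable_sphMoment hs he ht.le (j + 1) (σ - 1)).const_mul _), integral_const_mul]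

lemma sphMoment_eq_add (hlam : IsSphereMarginal d lam) (hs : 0 ≤ s) (he : 0 < e) (ht : 0 ≤ t)
    (j : ℕ) (σ : ℝ) :
    sphMoment lam s e j σ t = (s + t + e) * sphMoment lam s e j (σ - 1) t +
      2 * (√s * √t) * sphMoment lam s e (j + 1) (σ - 1) t := by
  unfold sphMoment
  rw [← integral_const_mul, ← integral_const_mul, ← integral_add
    ((hlam.integrable_sphMoment hs he ht j (σ - 1)).const_mul _)
    ((hlam.integrable_sphMoment hs he ht (j + 1) (σ - 1)).const_mul _)]
  refine integral_congr_ae ?_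
  filter_upwards [hlam.ae_mem] with u hu
  have hk := he.trans_le (le_sphKernel (e := e) hs ht hu)
  have : sphKernel s e t u ^ σ = sphKernel s e t u ^ (σ - 1) * sphKernel s e t u := by
    rw [← Real.rpow_add_one hk.ne']; congr 1; ring
  rw [this]
  conv_lhs => rw [sphKernel.eq_def s e t u]
  simp only [sphKernel]
  ring

/-- Integration by parts for g(u) = u^j k^σ. At j = 0 the truncated index j - 1 is harmless, since
its coefficient vanishes. -/
lemma sphMoment_succ (hlam : IsSphereMarginal d lam) (hs : 0 ≤ s) (he : 0 < e) (ht : 0 ≤ t)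
    (j : ℕ) (σ : ℝ) :
    ((d : ℝ) - 1) * sphMoment lam s e (j + 1) σ t =
      j * (sphMoment lam s e (j - 1) σ t - sphMoment lam s e (j + 1) σ t) +
      2 * (√s * √t) * σ * (sphMoment lam s e j (σ - 1) t - sphMoment lam s e (j + 2) (σ - 1) t) := by
  have hderiv : ∀ u ∈ Icc (-1 : ℝ) 1, HasDerivAt (fun u => u ^ j * sphKernel s e t u ^ σ)
      (j * (u ^ (j - 1) * sphKernel s e t u ^ σ) +
        2 * (√s * √t) * σ * (u ^ j * sphKernel s e t u ^ (σ - 1))) u := by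
    intro u hu
    have hk := he.trans_le (le_sphKernel (e := e) hs ht hu)
    have h1 : HasDerivAt (fun u => sphKernel s e t u) (2 * (√s * √t)) u := by
      unfold sphKernel
      exact (((hasDerivAt_id u).const_mul (2 * (√s * √t))).const_add (s + t + e)).congr_deriv
        (by ring)
    exact ((hasDerivAt_pow j u).mul (h1.rpow_const (p := σ) (Or.inl hk.ne'))).congr_deriv (by ring)
  have hcont : ContinuousOn (fun u => j * (u ^ (j - 1) * sphKernel s e t u ^ σ) +
        2 * (√s * √t) * σ * (u ^ j * sphKernel s e t u ^ (σ - 1))) (Icc (-1) 1) :=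
    (continuousOn_const.mul (continuousOn_sphMoment_integrand_right hs he ht _ _)).add
      (continuousOn_const.mul (continuousOn_sphMoment_integrand_right hs he ht _ _))
  have h := hlam.integral_id_mul _ _ hderiv hcont
  have hI := fun j σ => hlam.integrable_sphMoment (s := s) hs he ht j σ
  have h1 : Integrable (fun u => u ^ (j - 1) * sphKernel s e t u ^ σ -
      u ^ (j + 1) * sphKernel s e t u ^ σ) lam := (hI _ _).sub (hI _ _)
  have h2 : Integrable (fun u => u ^ j * sphKernel s e t u ^ (σ - 1) -
      u ^ (j + 2) * sphKernel s e t u ^ (σ - 1)) lam := (hI _ _).sub (hI _ _)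
  unfold sphMoment
  rw [← integral_sub (hI _ _) (hI _ _), ← integral_sub (hI _ _) (hI _ _), ← integral_const_mul,
    ← integral_const_mul, ← integral_const_mul, ← integral_add (h1.const_mul _) (h2.const_mul _)]
  rw [← integral_const_mul] at h
  refine Eq.trans ?_ (h.trans ?_)
  · congr 1
    ext u
    ring
  · congr 1
    ext u
    rcases j with _ | j
    · simp only [Nat.cast_zero]
      ring
    · simp only [Nat.add_sub_cancel]
      ring

lemma sphMoment_zero_one (hlam : IsSphereMarginal d lam) (hd : 2 ≤ d) :
    sphMoment lam s e 0 1 t = s + t + e := by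
  have := hlam.isProbabilityMeasure
  simp only [sphMoment, pow_zero, one_mul, Real.rpow_one, sphKernel]
  rw [integral_add (integrable_const _) ((hlam.integrable_of_continuousOn
    (f := fun u => u) (by fun_prop)).const_mul _), integral_const_mul, hlam.integral_id hd]
  simp

lemma sphMoment_sub_two_nonneg (hlam : IsSphereMarginal d lam) (hs : 0 ≤ s) (he : 0 < e)
    (ht : 0 ≤ t) (σ : ℝ) : 0 ≤ sphMoment lam s e 0 σ t - sphMoment lam s e 2 σ t := by
  unfold sphMoment
  rw [← integral_sub (hlam.integrable_sphMoment hs he ht _ _)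
    (hlam.integrable_sphMoment hs he ht _ _)]
  refine integral_nonneg_of_ae ?_
  filter_upwards [hlam.ae_mem] with u hu
  have hk := Real.rpow_nonneg (he.le.trans (le_sphKernel (e := e) hs ht hu)) σ
  have : u ^ 2 ≤ 1 := by nlinarith [hu.1, hu.2]
  simp only [Pi.zero_apply]
  nlinarith

/-- The combination is the integral of (1 - u²)² k^σ. -/
lemma sphMoment_sub_four_nonneg (hlam : IsSphereMarginal d lam) (hs : 0 ≤ s) (he : 0 < e)
    (ht : 0 ≤ t) (σ : ℝ) :
    0 ≤ (sphMoment lam s e 0 σ t - sphMoment lam s e 2 σ t) -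
      (sphMoment lam s e 2 σ t - sphMoment lam s e 4 σ t) := by
  have hI := fun j => hlam.integrable_sphMoment (s := s) hs he ht j σ
  have hJ : ∀ i j : ℕ, Integrable (fun u => u ^ i * sphKernel s e t u ^ σ -
      u ^ j * sphKernel s e t u ^ σ) lam := fun i j => (hI i).sub (hI j)
  unfold sphMoment
  rw [← integral_sub (hI _) (hI _), ← integral_sub (hI _) (hI _),
    ← integral_sub (hJ 0 2) (hJ 2 4)]
  refine integral_nonneg_of_ae ?_
  filter_upwards [hlam.ae_mem] with u hu
  have hk := Real.rpow_nonneg (he.le.trans (le_sphKernel (e := e) hs ht hu)) σ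
  have : 0 ≤ (1 - u ^ 2) ^ 2 * sphKernel s e t u ^ σ := by positivity
  simp only [Pi.zero_apply]
  linarith

lemma mul_sphMoment_sub_le (hlam : IsSphereMarginal d lam) (hs : 0 ≤ s) (he : 0 < e)
    (ht : 0 ≤ t) (σ : ℝ) :
    s * ((sphMoment lam s e 0 (σ - 1) t - sphMoment lam s e 2 (σ - 1) t) -
      (sphMoment lam s e 2 (σ - 1) t - sphMoment lam s e 4 (σ - 1) t)) ≤
      sphMoment lam s e 0 σ t - sphMoment lam s e 2 σ t := by
  have hI := fun j σ => hlam.integrable_sphMoment (s := s) hs he ht j σ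
  have hJ : ∀ (i j : ℕ) (σ : ℝ), Integrable (fun u => u ^ i * sphKernel s e t u ^ σ -
      u ^ j * sphKernel s e t u ^ σ) lam := fun i j σ => (hI i σ).sub (hI j σ)
  unfold sphMoment
  rw [← integral_sub (hI 0 _) (hI 2 _), ← integral_sub (hI 2 _) (hI 4 _),
    ← integral_sub (hJ 0 2 _) (hJ 2 4 _), ← integral_const_mul,
    ← integral_sub (hI _ _) (hI _ _)]
  refine integral_mono_ae (((hJ 0 2 _).sub (hJ 2 4 _)).const_mul _) (hJ 0 2 _) ?_
  filter_upwards [hlam.ae_mem] with u hu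
  have hk0 := he.trans_le (le_sphKernel (e := e) hs ht hu)
  have hk := Real.rpow_nonneg hk0.le (σ - 1)
  have h1 := mul_one_sub_sq_le_sphKernel (u := u) hs ht he.le
  have hu2 : 0 ≤ 1 - u ^ 2 := by nlinarith [hu.1, hu.2]
  have : sphKernel s e t u ^ σ = sphKernel s e t u ^ (σ - 1) * sphKernel s e t u := by
    rw [← Real.rpow_add_one hk0.ne']; congr 1; ring
  rw [this]
  have h2 := mul_le_mul_of_nonneg_left h1 (mul_nonneg hu2 hk)
  linarith

/-- The derivative of `sphMoment lam s e 0 σ`. -/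
def _root_.sphMomentDeriv (lam : Measure ℝ) (s e σ t : ℝ) : ℝ :=
  σ * (sphMoment lam s e 0 (σ - 1) t + √s / √t * sphMoment lam s e 1 (σ - 1) t)

/-- The second derivative of `sphMoment lam s e 0 σ`. -/
def _root_.sphMomentDeriv2 (lam : Measure ℝ) (d : ℕ) (s e σ t : ℝ) : ℝ :=
  σ * (σ - 1) / t * (sphMoment lam s e 0 (σ - 1) t - e * sphMoment lam s e 0 (σ - 2) t -
    s * (d / (d - 1)) * (sphMoment lam s e 0 (σ - 2) t - sphMoment lam s e 2 (σ - 2) t))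

lemma hasDerivAt_sphMoment_zero (hlam : IsSphereMarginal d lam) (hs : 0 ≤ s) (he : 0 < e)
    (ht : 0 < t) (σ : ℝ) :
    HasDerivAt (sphMoment lam s e 0 σ) (sphMomentDeriv lam s e σ t) t :=
  hlam.hasDerivAt_sphMoment hs he ht 0 σ

/-- Integration by parts turns the moment of U into a multiple of √s √t, which cancels the singular
factor 1/√t. -/
lemma sphMomentDeriv_eq (hlam : IsSphereMarginal d lam) (hd : 2 ≤ d) (hs : 0 ≤ s) (he : 0 < e)
    (ht : 0 < t) (σ : ℝ) :
    sphMomentDeriv lam s e σ t = σ * (sphMoment lam s e 0 (σ - 1) t + 2 * s * (σ - 1) / (d - 1) *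
      (sphMoment lam s e 0 (σ - 2) t - sphMoment lam s e 2 (σ - 2) t)) := by
  have hd' : (0 : ℝ) < d - 1 := by
    have : (2 : ℝ) ≤ d := by exact_mod_cast hd
    linarith
  have h := hlam.sphMoment_succ hs he ht.le 0 (σ - 1)
  have hB := Real.sqrt_pos.2 ht
  have h1 : sphMoment lam s e 1 (σ - 1) t = 2 * (√s * √t) * (σ - 1) / (d - 1) *
      (sphMoment lam s e 0 (σ - 2) t - sphMoment lam s e 2 (σ - 2) t) := by
    rw [show σ - 1 - 1 = σ - 2 by ring] at h
    field_simp
    push_cast at h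
    linear_combination h
  rw [sphMomentDeriv, h1]
  have hA := Real.sq_sqrt hs
  field_simp
  rw [hA]
  ring

lemma hasDerivAt_sphMomentDeriv (hlam : IsSphereMarginal d lam) (hd : 2 ≤ d) (hs : 0 ≤ s)
    (he : 0 < e) (ht : 0 < t) (σ : ℝ) :
    HasDerivAt (sphMomentDeriv lam s e σ) (sphMomentDeriv2 lam d s e σ t) t := by
  have hd' : (0 : ℝ) < d - 1 := by
    have : (2 : ℝ) ≤ d := by exact_mod_cast hd
    linarith
  have hB := Real.sqrt_pos.2 ht
  have hBt := Real.sq_sqrt ht.le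
  have hAs := Real.sq_sqrt hs
  have h := ((hlam.hasDerivAt_sphMoment hs he ht 0 (σ - 1)).add
    (((Real.hasDerivAt_sqrt ht.ne').fun_inv hB.ne' |>.const_mul √s).mul
      (hlam.hasDerivAt_sphMoment hs he ht 1 (σ - 1)))).const_mul σ
  refine (h.congr_deriv ?_).congr_of_eventuallyEq (Eventually.of_forall fun x => ?_)
  · have e1 := hlam.sphMoment_succ hs he ht.le 0 (σ - 1)
    have e2 := hlam.sphMoment_eq_add hs he ht.le 0 (σ - 1)
    rw [show σ - 1 - 1 = σ - 2 by ring] at e1 e2 ⊢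
    simp only [zero_add, Nat.cast_zero, zero_mul, one_add_one_eq_two] at e1 e2 ⊢
    have h1 : sphMoment lam s e 1 (σ - 1) t = 2 * (√s * √t) * (σ - 1) / (d - 1) *
        (sphMoment lam s e 0 (σ - 2) t - sphMoment lam s e 2 (σ - 2) t) := by
      field_simp
      linear_combination e1
    rw [sphMomentDeriv2, h1, e2]
    generalize sphMoment lam s e 0 (σ - 2) t = M0
    generalize sphMoment lam s e 1 (σ - 2) t = M1
    generalize sphMoment lam s e 2 (σ - 2) t = M2
    obtain ⟨A, hA⟩ : ∃ A, A = √s := ⟨_, rfl⟩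
    obtain ⟨B, hB'⟩ : ∃ B, B = √t := ⟨_, rfl⟩
    rw [← hA, ← hB']
    rw [← hA] at hAs
    rw [← hB'] at hBt hB
    rw [← hAs, ← hBt]
    field_simp
    ring
  · simp only [sphMomentDeriv, Pi.add_apply, Pi.mul_apply, div_eq_mul_inv]

/-- The radial equation `4 t Ψ'' + 2 d Ψ' = Δ`, up to normalisation. -/
lemma mul_sphMomentDeriv2_add (hlam : IsSphereMarginal d lam) (hd : 2 ≤ d) (hs : 0 ≤ s)
    (he : 0 < e) (ht : 0 < t) (σ : ℝ) :
    t * sphMomentDeriv2 lam d s e σ t + d / 2 * sphMomentDeriv lam s e σ t =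
      σ * (d + 2 * σ - 2) / 2 * sphMoment lam s e 0 (σ - 1) t -
        σ * (σ - 1) * e * sphMoment lam s e 0 (σ - 2) t := by
  have hd' : (0 : ℝ) < d - 1 := by
    have : (2 : ℝ) ≤ d := by exact_mod_cast hd
    linarith
  rw [hlam.sphMomentDeriv_eq hd hs he ht, sphMomentDeriv2]
  field_simp
  ring

/-- For `σ ≥ 2` the function `‖x + √t ξ‖ ^ (2 σ)` is strongly convex in `t` on average. -/
lemma le_sphMomentDeriv2_of_two_le (hlam : IsSphereMarginal d lam) (hd : 2 ≤ d) (hs : 0 ≤ s)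
    (he : 0 < e) (ht : 0 < t) (hσ : 2 ≤ σ) :
    σ * (σ - 1) * sphMoment lam s e 0 (σ - 2) t ≤ sphMomentDeriv2 lam d s e σ t := by
  have hd' : (0 : ℝ) < d - 1 := by
    have : (2 : ℝ) ≤ d := by exact_mod_cast hd
    linarith
  have hB := Real.sqrt_pos.2 ht
  have hBt := Real.sq_sqrt ht.le
  have hAs := Real.sq_sqrt hs
  have e0 := hlam.sphMoment_succ hs he ht.le 0 (σ - 2)
  have e1 := hlam.sphMoment_succ hs he ht.le 1 (σ - 2)
  have e2 := hlam.sphMoment_eq_add hs he ht.le 0 (σ - 1)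
  have e3 := hlam.sphMoment_succ hs he ht.le 0 (σ - 3)
  have e4 := hlam.sphMoment_succ hs he ht.le 2 (σ - 3)
  have p0 := hlam.sphMoment_sub_two_nonneg hs he ht.le (σ - 3)
  have p1 := hlam.sphMoment_sub_four_nonneg hs he ht.le (σ - 4)
  have p2 := hlam.mul_sphMoment_sub_le hs he ht.le (σ - 3)
  rw [show σ - 2 - 1 = σ - 3 by ring] at e0 e1
  rw [show σ - 1 - 1 = σ - 2 by ring] at e2
  rw [show σ - 3 - 1 = σ - 4 by ring] at e3 e4 p2
  simp only [zero_add, Nat.cast_zero, zero_mul, Nat.cast_one, one_mul, one_add_one_eq_two,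
    Nat.sub_self, Nat.cast_ofNat, Nat.reduceAdd, Nat.reduceSub] at e0 e1 e2 e3 e4
  -- The recursions express the difference through (1-U²) k^(σ-3) and (1-U²)² k^(σ-4), the second
  -- with coefficient (σ-3)/(d+1), possibly negative.
  have key : sphMomentDeriv2 lam d s e σ t - σ * (σ - 1) * sphMoment lam s e 0 (σ - 2) t =
      σ * (σ - 1) * (σ - 2) * (4 * s / (d - 1)) *
        ((sphMoment lam s e 0 (σ - 3) t - sphMoment lam s e 2 (σ - 3) t) +
        (σ - 3) / (d + 1) * (s * ((sphMoment lam s e 0 (σ - 4) t - sphMoment lam s e 2 (σ - 4) t) -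
          (sphMoment lam s e 2 (σ - 4) t - sphMoment lam s e 4 (σ - 4) t)))) := by
    rw [sphMomentDeriv2, e2]
    generalize sphMoment lam s e 0 (σ - 2) t = M0 at *
    generalize sphMoment lam s e 1 (σ - 2) t = M1 at *
    generalize sphMoment lam s e 2 (σ - 2) t = M2 at *
    generalize sphMoment lam s e 0 (σ - 3) t = N0 at *
    generalize sphMoment lam s e 1 (σ - 3) t = N1 at *
    generalize sphMoment lam s e 2 (σ - 3) t = N2 at *
    generalize sphMoment lam s e 3 (σ - 3) t = N3 at *
    generalize sphMoment lam s e 0 (σ - 4) t = K0 at *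
    generalize sphMoment lam s e 2 (σ - 4) t = K2 at *
    generalize sphMoment lam s e 4 (σ - 4) t = K4 at *
    generalize √s = A at *
    generalize √t = B at *
    have f1 : N1 - N3 = 2 * (A * B) * (σ - 3) / (d + 1) * (K0 - K2 - (K2 - K4)) := by
      field_simp
      linear_combination e3 - e4
    have f2 : M1 = 2 * (A * B) * (σ - 2) / (d - 1) * (N0 - N2) := by
      field_simp
      linear_combination e0
    have f3 : d * M2 = M0 + 2 * (A * B) * (σ - 2) *
        (2 * (A * B) * (σ - 3) / (d + 1) * (K0 - K2 - (K2 - K4))) := by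
      rw [← f1]
      linear_combination e1
    have hd0 : (0 : ℝ) < d := by linarith
    have f4 : M2 = (M0 + 2 * (A * B) * (σ - 2) *
        (2 * (A * B) * (σ - 3) / (d + 1) * (K0 - K2 - (K2 - K4)))) / d := by
      rw [← f3]; field_simp
    rw [f2, f4, ← hAs, ← hBt]
    field_simp
    ring
  have hpos : 0 ≤ (sphMoment lam s e 0 (σ - 3) t - sphMoment lam s e 2 (σ - 3) t) +
        (σ - 3) / (d + 1) * (s * ((sphMoment lam s e 0 (σ - 4) t - sphMoment lam s e 2 (σ - 4) t) -
          (sphMoment lam s e 2 (σ - 4) t - sphMoment lam s e 4 (σ - 4) t))) := by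
    have hz := mul_nonneg hs p1
    -- A negative coefficient is at least -1, and by `p2`, that is by s(1-u²) ≤ k, the first term
    -- absorbs the second.
    have hc : -1 ≤ (σ - 3) / (d + 1) := by
      rw [le_div_iff₀ (by linarith)]
      linarith
    nlinarith
  have : 0 ≤ σ * (σ - 1) * (σ - 2) * (4 * s / (d - 1)) := by
    have h1 : 0 ≤ σ - 2 := by linarith
    have h2 : 0 ≤ σ - 1 := by linarith
    positivity
  nlinarith [mul_nonneg this hpos]

end IsSphereMarginal

end SphereMoment

/-! ### Lower bounds for derivatives through the radial equation -/

section Convexity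

variable {d : ℕ} {lam : Measure ℝ} {s e t u σ : ℝ}

/-- Comparison principle, used below for functions carrying the factor t^(d/2), which forces the
value 0 at t = 0. -/
lemma nonneg_of_deriv_nonneg_of_zero {f f' : ℝ → ℝ} (hf : ContinuousOn f (Ici 0)) (h0 : f 0 = 0)
    (hd : ∀ t, 0 < t → HasDerivAt f (f' t) t) (hf' : ∀ t, 0 < t → 0 ≤ f' t) (ht : 0 ≤ t) :
    0 ≤ f t := by
  have hm : MonotoneOn f (Ici 0) := by
    refine monotoneOn_of_hasDerivWithinAt_nonneg (convex_Ici 0) hf (f' := f') ?_ ?_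
    · intro x hx
      rw [interior_Ici] at hx
      exact (hd x hx).hasDerivWithinAt
    · intro x hx
      rw [interior_Ici] at hx
      exact hf' x hx
  rw [← h0]
  exact hm self_mem_Ici ht ht

/-- For σ ≤ 0, y^σ = exp(σ log y) ≥ 1 + σ log y ≥ 1 + σ(y-1). -/
lemma one_add_mul_sub_one_le_rpow {y : ℝ} (hy : 0 < y) (hσ : σ ≤ 0) :
    1 + σ * (y - 1) ≤ y ^ σ := by
  rw [Real.rpow_def_of_pos hy]
  nlinarith [Real.add_one_le_exp (Real.log y * σ), Real.log_le_sub_one_of_pos hy]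

namespace IsSphereMarginal

/-- A form of `sphMomentDeriv` that is continuous up to `t = 0`. -/
def _root_.sphMomentDerivExt (lam : Measure ℝ) (d : ℕ) (s e σ t : ℝ) : ℝ :=
  σ * (sphMoment lam s e 0 (σ - 1) t + 2 * s * (σ - 1) / (d - 1) *
      (sphMoment lam s e 0 (σ - 2) t - sphMoment lam s e 2 (σ - 2) t))

lemma continuousOn_sphMomentDerivExt (hlam : IsSphereMarginal d lam) (hs : 0 ≤ s) (he : 0 < e)
    (σ : ℝ) : ContinuousOn (sphMomentDerivExt lam d s e σ) (Ici 0) := by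
  have h := fun j σ => hlam.continuousOn_sphMoment hs he j σ
  exact continuousOn_const.mul ((h _ _).add (continuousOn_const.mul ((h _ _).sub (h _ _))))

lemma hasDerivAt_sphMomentDerivExt (hlam : IsSphereMarginal d lam) (hd : 2 ≤ d) (hs : 0 ≤ s)
    (he : 0 < e) (ht : 0 < t) (σ : ℝ) :
    HasDerivAt (sphMomentDerivExt lam d s e σ) (sphMomentDeriv2 lam d s e σ t) t := by
  refine (hlam.hasDerivAt_sphMomentDeriv hd hs he ht σ).congr_of_eventuallyEq ?_
  filter_upwards [Ioi_mem_nhds ht] with x hx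
  exact (hlam.sphMomentDeriv_eq hd hs he hx σ).symm

/-- Jensen's inequality through the tangent line at the mean s + t + e of the kernel; the linear
term integrates to zero because E U = 0. -/
lemma rpow_le_sphMoment (hlam : IsSphereMarginal d lam) (hd : 2 ≤ d) (hs : 0 ≤ s) (he : 0 < e)
    (ht : 0 ≤ t) (hσ : σ ≤ 0) : (s + t + e) ^ σ ≤ sphMoment lam s e 0 σ t := by
  have := hlam.isProbabilityMeasure
  have hx : 0 < s + t + e := by linarith
  have h1 : ∀ y : ℝ, 0 < y → (s + t + e) ^ σ + σ * (s + t + e) ^ (σ - 1) * (y - (s + t + e)) ≤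
      y ^ σ := by
    intro y hy
    have h := one_add_mul_sub_one_le_rpow (div_pos hy hx) hσ
    rw [Real.div_rpow hy.le hx.le, le_div_iff₀ (Real.rpow_pos_of_pos hx _)] at h
    rw [Real.rpow_sub_one hx.ne']
    refine le_trans (le_of_eq ?_) h
    field_simp
  have h2 : ∫ u, ((s + t + e) ^ σ + σ * (s + t + e) ^ (σ - 1) * (sphKernel s e t u - (s + t + e)))
      ∂lam ≤ sphMoment lam s e 0 σ t := by
    refine integral_mono_ae (hlam.integrable_of_continuousOn ?_)
      (hlam.integrable_sphMoment hs he ht 0 σ) ?_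
    · unfold sphKernel
      fun_prop
    · filter_upwards [hlam.ae_mem] with u hu
      simpa using h1 _ (he.trans_le (le_sphKernel hs ht hu))
  refine le_trans (le_of_eq ?_) h2
  have h3 : ∀ u, (s + t + e) ^ σ + σ * (s + t + e) ^ (σ - 1) * (sphKernel s e t u - (s + t + e))
      = (s + t + e) ^ σ + (σ * (s + t + e) ^ (σ - 1) * (2 * (√s * √t))) * u := by
    intro u; unfold sphKernel; ring
  simp_rw [h3]
  rw [integral_add (integrable_const _) ((hlam.integrable_of_continuousOn
    (f := fun u => u) (by fun_prop)).const_mul _), integral_const_mul, hlam.integral_id hd]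
  simp

/-- The integrating factor t^(d/2) turns the radial operator t Ψ'' + (d/2) Ψ' into a derivative. Its
value is bounded below by Jensen for the exponent σ - 1 ≤ 0, and the term with e has a favourable
sign because σ ≤ 1. The constant makes the leading powers of s + t + e cancel. -/
lemma le_sphMomentDeriv (hlam : IsSphereMarginal d lam) (hd : 2 ≤ d) (hs : 0 ≤ s) (he : 0 < e)
    (ht : 0 < t) (h0 : 0 ≤ σ) (h1 : σ ≤ 1) :
    (2 * σ + d - 2) / d * σ * (s + t + e) ^ (σ - 1) ≤ sphMomentDeriv lam s e σ t := by
  have hd2 : (2 : ℝ) ≤ d := by exact_mod_cast hd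
  set D : ℝ := (d : ℝ) with hD
  have hx : ∀ t, 0 ≤ t → 0 < s + t + e := fun t ht => by linarith
  have key : 0 ≤ t ^ (D / 2) * (sphMomentDerivExt lam d s e σ t -
      (2 * σ + D - 2) / D * σ * (s + t + e) ^ (σ - 1)) := by
    refine nonneg_of_deriv_nonneg_of_zero (f := fun t => t ^ (D / 2) *
      (sphMomentDerivExt lam d s e σ t - (2 * σ + D - 2) / D * σ * (s + t + e) ^ (σ - 1)))
      (f' := fun t => D / 2 * t ^ (D / 2 - 1) * (sphMomentDerivExt lam d s e σ t -
        (2 * σ + D - 2) / D * σ * (s + t + e) ^ (σ - 1)) + t ^ (D / 2) *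
        (sphMomentDeriv2 lam d s e σ t -
          (2 * σ + D - 2) / D * σ * ((σ - 1) * (s + t + e) ^ (σ - 1 - 1)))) ?_ ?_ ?_ ?_ ht.le
    · refine ContinuousOn.mul (Real.continuous_rpow_const (by positivity)).continuousOn
        ((hlam.continuousOn_sphMomentDerivExt hs he σ).sub (continuousOn_const.mul
          (ContinuousOn.rpow_const (by fun_prop) ?_)))
      intro x h
      exact Or.inl (hx x h).ne'
    · rw [Real.zero_rpow (by positivity), zero_mul]
    · intro t ht
      have h2 := (((hasDerivAt_id t).const_add s).add_const e).rpow_const (p := σ - 1)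
        (Or.inl (hx t ht.le).ne')
      refine ((Real.hasDerivAt_rpow_const (Or.inl ht.ne')).mul
        ((hlam.hasDerivAt_sphMomentDerivExt hd hs he ht σ).sub
          (h2.const_mul ((2 * σ + D - 2) / D * σ)))).congr_deriv ?_
      simp only [id, Pi.sub_apply]
      ring
    · intro t ht
      have hode := hlam.mul_sphMomentDeriv2_add hd hs he ht σ
      have hEq : sphMomentDerivExt lam d s e σ t = sphMomentDeriv lam s e σ t :=
        (hlam.sphMomentDeriv_eq hd hs he ht σ).symm
      have hpow : t ^ (D / 2) = t ^ (D / 2 - 1) * t := by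
        rw [← Real.rpow_add_one ht.ne']; congr 1; ring
      have hJ := hlam.rpow_le_sphMoment hd hs he ht.le (σ := σ - 1) (by linarith)
      have hM : 0 ≤ sphMoment lam s e 0 (σ - 2) t :=
        (Real.rpow_nonneg (hx t ht.le).le _).trans
          (hlam.rpow_le_sphMoment hd hs he ht.le (σ := σ - 2) (by linarith))
      rw [hpow, hEq]
      have hy := Real.rpow_nonneg (hx t ht.le).le (σ - 1 - 1)
      have : 0 ≤ t ^ (D / 2 - 1) * (D / 2 * sphMomentDeriv lam s e σ t +
          t * sphMomentDeriv2 lam d s e σ t - (2 * σ + D - 2) * σ / 2 * (s + t + e) ^ (σ - 1) +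
          (2 * σ + D - 2) / D * σ * ((1 - σ) * (t * (s + t + e) ^ (σ - 1 - 1)))) := by
        refine mul_nonneg (Real.rpow_nonneg ht.le _) (add_nonneg ?_ ?_)
        · have h3 : 0 ≤ σ * (D + 2 * σ - 2) / 2 := by
            have : 0 ≤ D + 2 * σ - 2 := by linarith
            positivity
          have h4 := mul_le_mul_of_nonneg_left hJ h3
          have h5 : 0 ≤ σ * (1 - σ) * e * sphMoment lam s e 0 (σ - 2) t := by
            have : 0 ≤ 1 - σ := by linarith
            positivity
          linarith
        · have h3 : 0 ≤ 1 - σ := by linarith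
          have h4 : 0 ≤ 2 * σ + D - 2 := by linarith
          have h5 : 0 < D := by linarith
          positivity
      refine this.trans_eq ?_
      field_simp
      ring
  have hpos : 0 < t ^ (D / 2) := Real.rpow_pos_of_pos ht _
  have := nonneg_of_mul_nonneg_right key hpos
  rw [sphMomentDerivExt, ← hlam.sphMomentDeriv_eq hd hs he ht σ] at this
  linarith

lemma sphMoment_le_rpow (hlam : IsSphereMarginal d lam) (hs : 0 ≤ s) (he : 0 < e)
    (ht : 0 ≤ t) (hσ : σ ≤ 0) : sphMoment lam s e 0 σ t ≤ e ^ σ := by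
  have := hlam.isProbabilityMeasure
  have h : sphMoment lam s e 0 σ t ≤ ∫ _, e ^ σ ∂lam := by
    refine integral_mono_ae (hlam.integrable_sphMoment hs he ht 0 σ) (integrable_const _) ?_
    filter_upwards [hlam.ae_mem] with u hu
    simpa using Real.rpow_le_rpow_of_nonpos he (le_sphKernel hs ht hu) hσ
  simpa using h

/-- The radial equation expresses t Ψ'' by the moment of exponent q-1 and Ψ'. The comparison with
factor t^(d/2) is applied to that expression, with `le_sphMomentDeriv` at exponent q-1 as input. The
only loss is the regularisation term, controlled by e · E k^(q-2) ≤ e^(q-1). -/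
lemma le_sphMomentDeriv2_of_le_two (hlam : IsSphereMarginal d lam) (hd : 2 ≤ d) (hs : 0 ≤ s)
    (he : 0 < e) (ht : 0 < t) {q : ℝ} (h1 : 1 ≤ q) (h2 : q ≤ 2) :
    (2 * q + d - 2) * (2 * q + d - 4) / (d * (d + 2)) * (q * (q - 1)) * (s + t + e) ^ (q - 2) ≤
      sphMomentDeriv2 lam d s e q t + q * (q - 1) * e ^ (q - 1) / t := by
  have hd2 : (2 : ℝ) ≤ d := by exact_mod_cast hd
  set D : ℝ := (d : ℝ) with hD
  have hx : ∀ t, 0 ≤ t → 0 < s + t + e := fun t ht => by linarith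
  set A : ℝ := q * (D + 2 * q - 2) / 2 with hA
  have hA0 : 0 ≤ A := by
    have : 0 ≤ D + 2 * q - 2 := by linarith
    positivity
  set c : ℝ := (2 * q + D - 2) * (2 * q + D - 4) / (D * (D + 2)) * (q * (q - 1)) with hc
  have hc0 : 0 ≤ c := by
    have h3 : 0 ≤ 2 * q + D - 2 := by linarith
    have h4 : 0 ≤ 2 * q + D - 4 := by linarith
    have h5 : 0 ≤ q - 1 := by linarith
    positivity
  -- This relation dictates the value of c: differentiating t^(d/2) · t produces d/2 + 1, and the
  -- right side comes from the first-order bound at q-1.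
  have hcA : c * (D / 2 + 1) = A * ((2 * (q - 1) + D - 2) / D * (q - 1)) := by
    rw [hc, hA]
    field_simp
    ring
  have key : 0 ≤ t ^ (D / 2) * (A * sphMoment lam s e 0 (q - 1) t -
      D / 2 * sphMomentDerivExt lam d s e q t - c * (t * (s + t + e) ^ (q - 2))) := by
    refine nonneg_of_deriv_nonneg_of_zero (f := fun t => t ^ (D / 2) *
      (A * sphMoment lam s e 0 (q - 1) t - D / 2 * sphMomentDerivExt lam d s e q t -
        c * (t * (s + t + e) ^ (q - 2))))
      (f' := fun t => D / 2 * t ^ (D / 2 - 1) * (A * sphMoment lam s e 0 (q - 1) t -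
        D / 2 * sphMomentDerivExt lam d s e q t - c * (t * (s + t + e) ^ (q - 2))) +
        t ^ (D / 2) * (A * sphMomentDeriv lam s e (q - 1) t -
          D / 2 * sphMomentDeriv2 lam d s e q t -
          c * ((s + t + e) ^ (q - 2) + t * ((q - 2) * (s + t + e) ^ (q - 2 - 1))))) ?_ ?_ ?_ ?_ ht.le
    · refine ContinuousOn.mul (Real.continuous_rpow_const (by positivity)).continuousOn
        (((continuousOn_const.mul (hlam.continuousOn_sphMoment hs he _ _)).sub
        (continuousOn_const.mul (hlam.continuousOn_sphMomentDerivExt hs he q))).sub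
        (continuousOn_const.mul (continuousOn_id.mul
          (ContinuousOn.rpow_const (by fun_prop) ?_))))
      intro x h
      exact Or.inl (hx x h).ne'
    · rw [Real.zero_rpow (by positivity), zero_mul]
    · intro t ht
      have h2 := (((hasDerivAt_id t).const_add s).add_const e).rpow_const (p := q - 2)
        (Or.inl (hx t ht.le).ne')
      refine ((Real.hasDerivAt_rpow_const (Or.inl ht.ne')).mul
        ((((hlam.hasDerivAt_sphMoment_zero hs he ht (q - 1)).const_mul A).sub
        ((hlam.hasDerivAt_sphMomentDerivExt hd hs he ht q).const_mul (D / 2))).sub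
          (((hasDerivAt_id t).mul h2).const_mul c))).congr_deriv ?_
      simp only [id, Pi.sub_apply, Pi.mul_apply]
      ring
    · intro t ht
      have hode := hlam.mul_sphMomentDeriv2_add hd hs he ht q
      rw [← hD, ← hA] at hode
      have hEq : sphMomentDerivExt lam d s e q t = sphMomentDeriv lam s e q t :=
        (hlam.sphMomentDeriv_eq hd hs he ht q).symm
      have hpow : t ^ (D / 2) = t ^ (D / 2 - 1) * t := by
        rw [← Real.rpow_add_one ht.ne']; congr 1; ring
      have hJ := hlam.le_sphMomentDeriv hd hs he ht (σ := q - 1) (by linarith) (by linarith)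
      have hM : 0 ≤ sphMoment lam s e 0 (q - 2) t :=
        (Real.rpow_nonneg (hx t ht.le).le _).trans
          (hlam.rpow_le_sphMoment hd hs he ht.le (σ := q - 2) (by linarith))
      rw [show q - 1 - 1 = q - 2 by ring] at hJ
      rw [hpow, hEq]
      have hy := Real.rpow_nonneg (hx t ht.le).le (q - 2 - 1)
      have : 0 ≤ t ^ (D / 2 - 1) * (D / 2 * (q * (q - 1) * e * sphMoment lam s e 0 (q - 2) t) +
          t * (A * sphMomentDeriv lam s e (q - 1) t - c * (D / 2 + 1) * (s + t + e) ^ (q - 2)) +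
          c * (2 - q) * (t * (t * (s + t + e) ^ (q - 2 - 1)))) := by
        have h3 : 0 ≤ q - 1 := by linarith
        have h4 : 0 ≤ 2 - q := by linarith
        refine mul_nonneg (Real.rpow_nonneg ht.le _) (add_nonneg (add_nonneg ?_ ?_) ?_)
        · positivity
        · refine mul_nonneg ht.le ?_
          rw [hcA]
          have := mul_le_mul_of_nonneg_left hJ hA0
          linarith
        · positivity
      refine this.trans_eq ?_
      have hode' : q * (q - 1) * e * sphMoment lam s e 0 (q - 2) t =
          A * sphMoment lam s e 0 (q - 1) t - t * sphMomentDeriv2 lam d s e q t -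
            D / 2 * sphMomentDeriv lam s e q t := by
        linarith
      rw [hode']
      ring
  have hpos : 0 < t ^ (D / 2) := Real.rpow_pos_of_pos ht _
  have hk := nonneg_of_mul_nonneg_right key hpos
  rw [sphMomentDerivExt, ← hlam.sphMomentDeriv_eq hd hs he ht q] at hk
  have hode := hlam.mul_sphMomentDeriv2_add hd hs he ht q
  rw [← hD, ← hA] at hode
  have hM := hlam.sphMoment_le_rpow hs he ht.le (σ := q - 2) (by linarith)
  have he2 : e * e ^ (q - 2) = e ^ (q - 1) := by
    rw [mul_comm, ← Real.rpow_add_one he.ne']; congr 1; ring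
  have h3 : q * (q - 1) * (e * sphMoment lam s e 0 (q - 2) t) ≤ q * (q - 1) * e ^ (q - 1) := by
    rw [← he2]
    have : 0 ≤ q - 1 := by linarith
    gcongr
  rw [← sub_nonneg]
  have h4 : 0 ≤ t * (sphMomentDeriv2 lam d s e q t + q * (q - 1) * e ^ (q - 1) / t -
      c * (s + t + e) ^ (q - 2)) := by
    have : t * (q * (q - 1) * e ^ (q - 1) / t) = q * (q - 1) * e ^ (q - 1) := by field_simp
    have hode' : t * sphMomentDeriv2 lam d s e q t =
          A * sphMoment lam s e 0 (q - 1) t - q * (q - 1) * (e * sphMoment lam s e 0 (q - 2) t) -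
            D / 2 * sphMomentDeriv lam s e q t := by
        linarith
    rw [mul_sub, mul_add, this, hode']
    linarith
  exact nonneg_of_mul_nonneg_right h4 ht

end IsSphereMarginal

end Convexity

/-! ### Polynomial minorants of ψ'' and removal of the regularisation -/

section ConvexityLimit

variable {d : ℕ} {lam : Measure ℝ} {s e t u σ : ℝ}

/-- A quartic polynomial with second derivative `α + β x + δ x ^ 2`. -/
def quarticAux (α β δ x : ℝ) : ℝ := α * x ^ 2 / 2 + β * x ^ 3 / 6 + δ * x ^ 4 / 12

namespace IsSphereMarginal

lemma add_mul_le_sphMoment (hlam : IsSphereMarginal d lam) (hd : 2 ≤ d) (hs : 0 ≤ s) (he : 0 < e)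
    (ht : 0 ≤ t) {a b : ℝ}
    (h : ∀ u ∈ Icc (-1 : ℝ) 1, a + b * sphKernel s e t u ≤ sphKernel s e t u ^ σ) :
    a + b * (s + t + e) ≤ sphMoment lam s e 0 σ t := by
  have := hlam.isProbabilityMeasure
  have hi : Integrable (fun u => sphKernel s e t u) lam :=
    hlam.integrable_of_continuousOn (by unfold sphKernel; fun_prop)
  have h1 : ∫ u, (a + b * sphKernel s e t u) ∂lam ≤ sphMoment lam s e 0 σ t := by
    refine integral_mono_ae ((integrable_const _).add (hi.const_mul _))
      (hlam.integrable_sphMoment hs he ht 0 σ) ?_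
    filter_upwards [hlam.ae_mem] with u hu
    simpa using h u hu
  refine le_trans (le_of_eq ?_) h1
  rw [integral_add (integrable_const _) (hi.const_mul _), integral_const_mul]
  have h2 := hlam.sphMoment_zero_one (s := s) (e := e) (t := t) hd
  simp only [sphMoment, pow_zero, one_mul, Real.rpow_one] at h2
  rw [h2]
  simp

/-- Bernoulli's inequality for the kernel, integrated. -/
lemma le_sphMoment_of_one_le (hlam : IsSphereMarginal d lam) (hd : 2 ≤ d) (hs : 0 ≤ s) (he : 0 < e)
    (ht : 0 ≤ t) (hσ : 1 ≤ σ) : 1 + σ * (s + t + e - 1) ≤ sphMoment lam s e 0 σ t := by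
  have h := hlam.add_mul_le_sphMoment hd hs he ht (σ := σ) (a := 1 - σ) (b := σ) (fun u hu => ?_)
  · linarith
  · have hk := he.trans_le (le_sphKernel (e := e) hs ht hu)
    have := one_add_mul_self_le_rpow_one_add (s := sphKernel s e t u - 1) (by linarith) hσ
    rw [add_sub_cancel] at this
    linarith

/-- The minorant of k^σ has to be affine in k for its integral to be explicit; its slope may depend
on the mean s + t + e, which makes the outcome quadratic. -/
lemma le_sphMoment_of_le_one (hlam : IsSphereMarginal d lam) (hd : 2 ≤ d) (hs : 0 ≤ s) (he : 0 < e)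
    (ht : 0 ≤ t) (h0 : 0 ≤ σ) (h1 : σ ≤ 1) :
    (s + t + e) / 4 - (s + t + e) ^ 2 / 32 ≤ sphMoment lam s e 0 σ t := by
  have h := hlam.add_mul_le_sphMoment hd hs he ht (σ := σ) (a := 0)
    (b := 1 / 4 - (s + t + e) / 32) (fun u hu => ?_)
  · linarith
  · have hk := he.trans_le (le_sphKernel (e := e) hs ht hu)
    have hle : sphKernel s e t u ≤ 2 * (s + t + e) := by
      have h2 := Real.sq_sqrt hs
      have h3 := Real.sq_sqrt ht
      have h4 := mul_nonneg (Real.sqrt_nonneg s) (Real.sqrt_nonneg t)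
      unfold sphKernel
      nlinarith [hu.2, sq_nonneg (√s - √t)]
    set k := sphKernel s e t u
    -- This is k ≤ 2(s + t + e). The quadratic on the right has maximum 1, at k = 8, and is at most
    -- k, so it lies below min(1, k) ≤ k^σ.
    have h5 : 0 + (1 / 4 - (s + t + e) / 32) * k ≤ k / 4 - k ^ 2 / 64 := by nlinarith
    refine h5.trans ?_
    rcases le_total 1 k with hk1 | hk1
    · have := Real.one_le_rpow hk1 h0
      nlinarith [sq_nonneg (k - 8)]
    · have := Real.rpow_le_rpow_of_exponent_ge hk hk1 h1
      rw [Real.rpow_one] at this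
      nlinarith

lemma tendsto_sphMoment (hlam : IsSphereMarginal d lam) (hσ : 0 ≤ σ) :
    Tendsto (fun e => sphMoment lam s e 0 σ t) (𝓝[>] 0) (𝓝 (sphMoment lam s 0 0 σ t)) := by
  have := hlam.isProbabilityMeasure
  have hc : Continuous fun p : ℝ × ℝ => p.2 ^ 0 * sphKernel s p.1 t p.2 ^ σ := by
    refine Continuous.mul (by fun_prop) (Continuous.rpow_const ?_ fun _ => Or.inr hσ)
    unfold sphKernel
    fun_prop
  obtain ⟨C, hC⟩ := (isCompact_Icc.prod isCompact_Icc).exists_bound_of_continuousOn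
    (hc.continuousOn (s := Icc (0 : ℝ) 1 ×ˢ Icc (-1 : ℝ) 1))
  refine tendsto_integral_filter_of_dominated_convergence (fun _ => C) ?_ ?_
    (integrable_const _) ?_
  · refine Eventually.of_forall fun e => Continuous.aestronglyMeasurable ?_
    exact hc.comp (Continuous.prodMk_right e)
  · filter_upwards [Ioo_mem_nhdsGT (zero_lt_one' ℝ)] with e he
    filter_upwards [hlam.ae_mem] with u hu
    exact hC (e, u) ⟨⟨he.1.le, he.2.le⟩, hu⟩
  · refine Eventually.of_forall fun u => ?_
    exact ((hc.comp (Continuous.prodMk_left u)).tendsto 0).mono_left nhdsWithin_le_nhds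

/-- The error E(e)/t integrates twice to E(e) t log t, which is continuous up to t = 0 and tends to
0 with e. Convexity is a pointwise inequality, so it survives the limit with no control of second
derivatives at e = 0. -/
lemma convexOn_sphMoment_sub (hlam : IsSphereMarginal d lam) (hd : 2 ≤ d) (hs : 0 ≤ s)
    (hσ : 0 ≤ σ) {α β δ : ℝ} {E : ℝ → ℝ} (hE : Tendsto E (𝓝[>] 0) (𝓝 0))
    (h : ∀ e, 0 < e → ∀ t, 0 < t → α + β * (s + t + e) + δ * (s + t + e) ^ 2 ≤
      sphMomentDeriv2 lam d s e σ t + E e / t) :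
    ConvexOn ℝ (Ici 0) fun t => sphMoment lam s 0 0 σ t - quarticAux α β δ (s + t) := by
  have hconv : ∀ e, 0 < e → ConvexOn ℝ (Ici 0) fun t => sphMoment lam s e 0 σ t +
      E e * (t * Real.log t) - quarticAux α β δ (s + t + e) := by
    intro e he
    refine convexOn_of_hasDerivWithinAt2_nonneg (convex_Ici 0)
      (f' := fun t => sphMomentDeriv lam s e σ t + E e * (Real.log t + 1) -
        (α * (s + t + e) + β * (s + t + e) ^ 2 / 2 + δ * (s + t + e) ^ 3 / 3))
      (f'' := fun t => sphMomentDeriv2 lam d s e σ t + E e * t⁻¹ -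
        (α + β * (s + t + e) + δ * (s + t + e) ^ 2)) ?_ ?_ ?_ ?_
    · refine ((hlam.continuousOn_sphMoment hs he 0 σ).add
        (continuous_const.mul Real.continuous_mul_log).continuousOn).sub ?_
      unfold quarticAux
      fun_prop
    · intro t ht
      rw [interior_Ici] at ht
      have hx : HasDerivAt (fun t => s + t + e) 1 t :=
        ((hasDerivAt_id t).const_add s).add_const e
      have hq : HasDerivAt (fun t => quarticAux α β δ (s + t + e))
          (α * (s + t + e) + β * (s + t + e) ^ 2 / 2 + δ * (s + t + e) ^ 3 / 3) t := by
        unfold quarticAux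
        refine (((((hx.fun_pow 2).const_mul α).div_const 2).add
          (((hx.fun_pow 3).const_mul β).div_const 6)).add
          (((hx.fun_pow 4).const_mul δ).div_const 12)).congr_deriv ?_
        push_cast
        ring
      exact (((hlam.hasDerivAt_sphMoment_zero hs he ht σ).add
        ((Real.hasDerivAt_mul_log (ne_of_gt ht)).const_mul (E e))).sub hq).hasDerivWithinAt
    · intro t ht
      rw [interior_Ici] at ht
      have hx : HasDerivAt (fun t => s + t + e) 1 t :=
        ((hasDerivAt_id t).const_add s).add_const e
      have hq : HasDerivAt (fun t => α * (s + t + e) + β * (s + t + e) ^ 2 / 2 +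
          δ * (s + t + e) ^ 3 / 3) (α + β * (s + t + e) + δ * (s + t + e) ^ 2) t := by
        refine (((hx.const_mul α).add
          (((hx.fun_pow 2).const_mul β).div_const 2)).add
          (((hx.fun_pow 3).const_mul δ).div_const 3)).congr_deriv ?_
        push_cast
        ring
      exact (((hlam.hasDerivAt_sphMomentDeriv hd hs he ht σ).add
        (((Real.hasDerivAt_log (ne_of_gt ht)).add_const 1).const_mul (E e))).sub
          hq).hasDerivWithinAt
    · intro t ht
      rw [interior_Ici] at ht
      have := h e he t ht
      rw [← div_eq_mul_inv]
      linarith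
  have hlim : ∀ t, Tendsto (fun e => sphMoment lam s e 0 σ t + E e * (t * Real.log t) -
      quarticAux α β δ (s + t + e)) (𝓝[>] 0)
      (𝓝 (sphMoment lam s 0 0 σ t - quarticAux α β δ (s + t))) := by
    intro t
    have h1 : Tendsto (fun e => quarticAux α β δ (s + t + e)) (𝓝[>] 0)
        (𝓝 (quarticAux α β δ (s + t))) := by
      have : Continuous fun e => quarticAux α β δ (s + t + e) := by
        unfold quarticAux
        fun_prop
      simpa using (this.tendsto 0).mono_left nhdsWithin_le_nhds
    simpa using ((hlam.tendsto_sphMoment hσ).add (hE.mul_const (t * Real.log t))).sub h1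
  refine ⟨convex_Ici 0, fun x hx y hy a b ha hb hab => ?_⟩
  refine le_of_tendsto_of_tendsto (hlim _)
    (((hlim x).const_smul a).add ((hlim y).const_smul b)) ?_
  filter_upwards [self_mem_nhdsWithin] with e he
  exact (hconv e he).2 hx hy ha hb hab

lemma convexOn_sphMoment_of_le_two (hlam : IsSphereMarginal d lam) (hd : 2 ≤ d) (hs : 0 ≤ s)
    {q : ℝ} (h1 : 1 ≤ q) (h2 : q ≤ 2) {c : ℝ}
    (hc : c = (2 * q + d - 2) * (2 * q + d - 4) / (d * (d + 2)) * (q * (q - 1))) :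
    ConvexOn ℝ (Ici 0) fun t => sphMoment lam s 0 0 q t -
      quarticAux c (-(c / 4)) 0 (s + t) := by
  have hd2 : (2 : ℝ) ≤ d := by exact_mod_cast hd
  have hc0 : 0 ≤ c := by
    have h3 : 0 ≤ 2 * q + d - 2 := by linarith
    have h4 : 0 ≤ 2 * q + d - 4 := by linarith
    have h5 : 0 ≤ q - 1 := by linarith
    rw [hc]
    positivity
  refine hlam.convexOn_sphMoment_sub hd hs (by linarith)
    (E := fun e => q * (q - 1) * e ^ (q - 1)) ?_ fun e he t ht => ?_
  · rcases h1.eq_or_lt with rfl | h1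
    · simp
    · have : Tendsto (fun e : ℝ => e ^ (q - 1)) (𝓝[>] 0) (𝓝 0) := by
        have := ((Real.continuous_rpow_const (q := q - 1) (by linarith)).tendsto 0)
        rw [Real.zero_rpow (by linarith)] at this
        exact this.mono_left nhdsWithin_le_nhds
      simpa using this.const_mul (q * (q - 1))
  · have h := hlam.le_sphMomentDeriv2_of_le_two hd hs he ht h1 h2
    rw [← hc] at h
    refine le_trans ?_ h
    have hx : 0 < s + t + e := by linarith
    -- The left side is the tangent line of 1/X at X = 2. For X ≥ 1 one has X^(q-2) ≥ 1/X, and for X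
    -- ≤ 1 the power is at least 1.
    have h3 : 1 - (s + t + e) / 4 ≤ (s + t + e) ^ (q - 2) := by
      rcases le_total 1 (s + t + e) with hk | hk
      · have := Real.rpow_le_rpow_of_exponent_le hk (show (-1 : ℝ) ≤ q - 2 by linarith)
        rw [Real.rpow_neg_one] at this
        refine le_trans ?_ this
        rw [inv_eq_one_div, le_div_iff₀ hx]
        nlinarith [sq_nonneg (s + t + e - 2)]
      · have := Real.one_le_rpow_of_pos_of_le_one_of_nonpos hx hk (show q - 2 ≤ 0 by linarith)
        linarith
    have := mul_le_mul_of_nonneg_left h3 hc0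
    linarith

lemma convexOn_sphMoment_of_le_three (hlam : IsSphereMarginal d lam) (hd : 2 ≤ d) (hs : 0 ≤ s)
    {q : ℝ} (h1 : 2 ≤ q) (h2 : q ≤ 3) :
    ConvexOn ℝ (Ici 0) fun t => sphMoment lam s 0 0 q t -
      quarticAux 0 (q * (q - 1) / 4) (-(q * (q - 1) / 32)) (s + t) := by
  refine hlam.convexOn_sphMoment_sub hd hs (by linarith)
    (E := fun _ => 0) tendsto_const_nhds fun e he t ht => ?_
  have h := hlam.le_sphMomentDeriv2_of_two_le hd hs he ht h1
  have h3 := hlam.le_sphMoment_of_le_one hd hs he ht.le (σ := q - 2) (by linarith) (by linarith)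
  have h4 : 0 ≤ q * (q - 1) := by nlinarith
  have := mul_le_mul_of_nonneg_left h3 h4
  rw [zero_div]
  linarith

lemma convexOn_sphMoment_of_three_le (hlam : IsSphereMarginal d lam) (hd : 2 ≤ d) (hs : 0 ≤ s)
    {q : ℝ} (h1 : 3 ≤ q) :
    ConvexOn ℝ (Ici 0) fun t => sphMoment lam s 0 0 q t -
      quarticAux (q * (q - 1) * (3 - q)) (q * (q - 1) * (q - 2)) 0 (s + t) := by
  refine hlam.convexOn_sphMoment_sub hd hs (by linarith)
    (E := fun _ => 0) tendsto_const_nhds fun e he t ht => ?_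
  have h := hlam.le_sphMomentDeriv2_of_two_le hd hs he ht (by linarith : 2 ≤ q)
  have h3 := hlam.le_sphMoment_of_one_le hd hs he ht.le (σ := q - 2) (by linarith)
  have h4 : 0 ≤ q * (q - 1) := by nlinarith
  have := mul_le_mul_of_nonneg_left h3 h4
  rw [zero_div]
  linarith

end IsSphereMarginal

end ConvexityLimit

/-! ### Measures with all norm moments finite -/

section Moments

/-- All polynomial moments of the norm are finite. -/
def HasNormMoments {E : Type*} [NormedAddCommGroup E] [MeasurableSpace E] (μ : Measure E) : Prop :=
  ∀ m : ℕ, Integrable (fun x => ‖x‖ ^ m) μ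

variable {E : Type*} [NormedAddCommGroup E] [MeasurableSpace E] [BorelSpace E] {μ ν : Measure E}

lemma HasNormMoments.map_smul [NormedSpace ℝ E] (hμ : HasNormMoments μ) (a : ℝ) :
    HasNormMoments (μ.map fun x => a • x) := by
  intro m
  rw [integrable_map_measure (by fun_prop) (by fun_prop)]
  refine ((hμ m).const_mul (|a| ^ m)).congr (Eventually.of_forall fun x => ?_)
  simp [norm_smul, mul_pow]

variable [IsProbabilityMeasure μ] [IsProbabilityMeasure ν]

lemma HasNormMoments.integrable_one_add_pow (hμ : HasNormMoments μ) (m : ℕ) :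
    Integrable (fun x => (1 + ‖x‖) ^ m) μ := by
  refine (((integrable_const (1 ^ m)).add (hμ m)).const_mul (2 ^ (m - 1))).mono'
    (by fun_prop) (Eventually.of_forall fun x => ?_)
  rw [Real.norm_of_nonneg (by positivity)]
  exact add_pow_le zero_le_one (norm_nonneg x) m

lemma HasNormMoments.integrable_of_le (hμ : HasNormMoments μ) {f : E → ℝ}
    (hf : AEStronglyMeasurable f μ) {C : ℝ} {m : ℕ} (h : ∀ᵐ x ∂μ, |f x| ≤ C * (1 + ‖x‖) ^ m) :
    Integrable f μ :=
  ((hμ.integrable_one_add_pow m).const_mul C).mono' hf h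

lemma HasNormMoments.integrable_prod_of_le (hμ : HasNormMoments μ) (hν : HasNormMoments ν)
    {f : E × E → ℝ} (hf : AEStronglyMeasurable f (μ.prod ν)) {C : ℝ} {m : ℕ}
    (h : ∀ᵐ z ∂(μ.prod ν), |f z| ≤ C * (1 + ‖z.1‖ + ‖z.2‖) ^ m) : Integrable f (μ.prod ν) := by
  refine (((hμ.integrable_one_add_pow m).mul_prod (hν.integrable_one_add_pow m)).const_mul
    |C|).mono' hf ?_
  filter_upwards [h] with z hz
  refine hz.trans ?_
  rw [← mul_pow]
  gcongr
  · exact le_abs_self C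
  · nlinarith [norm_nonneg z.1, norm_nonneg z.2, mul_nonneg (norm_nonneg z.1) (norm_nonneg z.2)]

lemma HasNormMoments.conv [SecondCountableTopology E] (hμ : HasNormMoments μ)
    (hν : HasNormMoments ν) : HasNormMoments (μ ∗ ν) := by
  intro m
  rw [Measure.conv, integrable_map_measure (by fun_prop) (by fun_prop)]
  refine hμ.integrable_prod_of_le hν (C := 1) (m := m) (by fun_prop)
    (Eventually.of_forall fun z => ?_)
  simp only [Function.comp, abs_pow, abs_norm, one_mul]
  gcongr
  linarith [norm_add_le z.1 z.2]

end Moments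

/-! ### Moment recursion for the one-dimensional Gaussian -/

section GaussianReal

open scoped NNReal

lemma integrable_pow_mul_gaussianPDFReal {v : ℝ≥0} (hv : v ≠ 0) (k : ℕ) :
    Integrable (fun x => x ^ k * gaussianPDFReal 0 v x) := by
  have hb : 0 < 1 / (2 * (v : ℝ)) := by positivity
  have h := (integrable_rpow_mul_exp_neg_mul_sq hb (s := k) (by
    have : (0 : ℝ) ≤ k := k.cast_nonneg
    linarith)).const_mul (√(2 * Real.pi * v))⁻¹
  refine h.congr (Eventually.of_forall fun x => ?_)
  simp only [gaussianPDFReal, Real.rpow_natCast, sub_zero]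
  rw [show -(1 / (2 * (v : ℝ))) * x ^ 2 = -x ^ 2 / (2 * v) by ring]
  ring

/-- Gaussian integration by parts: the density satisfies φ'(x) = -(x/v) φ(x). The degenerate
variance v = 0 is a point mass. -/
lemma integral_pow_add_two_gaussianReal (v : ℝ≥0) (k : ℕ) :
    ∫ x, x ^ (k + 2) ∂(gaussianReal 0 v) = v * (k + 1) * ∫ x, x ^ k ∂(gaussianReal 0 v) := by
  rcases eq_or_ne v 0 with rfl | hv
  · simp [gaussianReal_zero_var]
  have hv' : (v : ℝ) ≠ 0 := by exact_mod_cast hv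
  rw [integral_gaussianReal_eq_integral_smul hv, integral_gaussianReal_eq_integral_smul hv]
  have h := integral_mul_deriv_eq_deriv_mul_of_integrable (u := fun x : ℝ => x ^ (k + 1))
    (v := gaussianPDFReal 0 v) (u' := fun x => ((k : ℝ) + 1) * x ^ k)
    (v' := fun x => -(x / v) * gaussianPDFReal 0 v x)
    (fun x _ => by simpa using hasDerivAt_pow (k + 1) x)
    (fun x _ => by
      unfold gaussianPDFReal
      refine (((((hasDerivAt_id x).sub_const 0).fun_pow 2).fun_neg.div_const
        (2 * (v : ℝ))).exp.const_mul _).congr_deriv ?_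
      simp only [id, sub_zero]
      field_simp
      ring)
    (((integrable_pow_mul_gaussianPDFReal hv (k + 2)).const_mul (-(v : ℝ)⁻¹)).congr
      (Eventually.of_forall fun x => by simp only [Pi.mul_apply]; ring))
    (((integrable_pow_mul_gaussianPDFReal hv k).const_mul ((k : ℝ) + 1)).congr
      (Eventually.of_forall fun x => by simp only [Pi.mul_apply]; ring))
    (integrable_pow_mul_gaussianPDFReal hv (k + 1))
  have e1 : ∀ x : ℝ, gaussianPDFReal 0 v x • x ^ (k + 2) =
      -(v : ℝ) * (x ^ (k + 1) * (-(x / v) * gaussianPDFReal 0 v x)) := by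
    intro x
    rw [smul_eq_mul]
    field_simp
    ring
  have e2 : ∀ x : ℝ, ((k : ℝ) + 1) * x ^ k * gaussianPDFReal 0 v x =
      (k + 1) * (gaussianPDFReal 0 v x • x ^ k) := by
    intro x
    rw [smul_eq_mul]
    ring
  simp_rw [e1]
  simp_rw [e2] at h
  rw [integral_const_mul, h, integral_const_mul]
  ring

end GaussianReal

/-! ### The normalised Gaussian: invariance, stability, moments -/

section Gaussian

variable {d : ℕ}

lemma charFun_gaussianNormalized (t : EuclideanSpace ℝ (Fin d)) :
    charFun (gaussianNormalized d) t = Complex.exp (-((‖t‖ ^ 2 / (2 * d) : ℝ) : ℂ)) := by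
  have hS : ((1 / (d : ℝ)) • (1 : Matrix (Fin d) (Fin d) ℝ)).PosSemidef :=
    Matrix.PosSemidef.one.smul (by positivity)
  rw [gaussianNormalized, charFun_multivariateGaussian hS]
  congr 1
  have h : t.ofLp ⬝ᵥ (((1 / (d : ℝ)) • (1 : Matrix (Fin d) (Fin d) ℝ)).mulVec t.ofLp) =
      ‖t‖ ^ 2 / d := by
    rw [Matrix.smul_mulVec, Matrix.one_mulVec, dotProduct_smul, EuclideanSpace.real_norm_sq_eq,
      smul_eq_mul, dotProduct]
    simp only [← sq]
    ring
  rw [h]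
  simp only [inner_zero_right]
  push_cast
  ring

instance isGaussian_gaussianNormalized : IsGaussian (gaussianNormalized d) := by
  unfold gaussianNormalized
  infer_instance

lemma isometryInvariant_gaussianNormalized : IsometryInvariant (gaussianNormalized d) := by
  intro L
  have : IsProbabilityMeasure ((gaussianNormalized d).map L) :=
    Measure.isProbabilityMeasure_map L.continuous.aemeasurable
  refine Measure.ext_of_charFun (funext fun t => ?_)
  have h : charFun ((gaussianNormalized d).map L) t =
      charFun (gaussianNormalized d) (L.symm t) := by
    rw [charFun_apply, charFun_apply, integral_map L.continuous.aemeasurable (by fun_prop)]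
    congr 1
    ext x
    rw [← L.inner_map_map x (L.symm t), L.apply_symm_apply]
  rw [h, charFun_gaussianNormalized, charFun_gaussianNormalized, L.symm.norm_map]

lemma gaussianNormalized_map_smul_conv (a b c : ℝ) (h : a ^ 2 + b ^ 2 = c ^ 2) :
    ((gaussianNormalized d).map fun x => a • x) ∗ ((gaussianNormalized d).map fun x => b • x) =
      (gaussianNormalized d).map fun x => c • x := by
  have hp : ∀ a : ℝ, IsProbabilityMeasure ((gaussianNormalized d).map fun x => a • x) :=
    fun a => Measure.isProbabilityMeasure_map (by fun_prop)
  have := hp a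
  have := hp b
  have := hp c
  refine Measure.ext_of_charFun (funext fun t => ?_)
  rw [charFun_conv, charFun_map_smul, charFun_map_smul, charFun_map_smul,
    charFun_gaussianNormalized, charFun_gaussianNormalized, charFun_gaussianNormalized,
    ← Complex.exp_add]
  congr 1
  rw [← neg_add, ← Complex.ofReal_add]
  congr 2
  simp only [norm_smul, mul_pow, Real.norm_eq_abs, sq_abs]
  rw [← h]
  ring

lemma hasNormMoments_gaussianNormalized : HasNormMoments (gaussianNormalized d) := by
  intro m
  rcases eq_or_ne m 0 with rfl | hm
  · simp
  · exact (IsGaussian.memLp_id (gaussianNormalized d) m (by simp)).integrable_norm_pow hm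

lemma hasNormMoments_uniformSphere (hd : 1 ≤ d) : HasNormMoments (uniformSphere d) := by
  have := isProbabilityMeasure_uniformSphere hd
  intro m
  refine (integrable_const (1 : ℝ)).congr ?_
  filter_upwards [ae_norm_eq_one_uniformSphere] with x hx
  simp [hx]

lemma gaussianNormalized_map_eval (i : Fin d) :
    (gaussianNormalized d).map (fun x => x i) = gaussianReal 0 (1 / (d : NNReal)) := by
  have hS : ((1 / (d : ℝ)) • (1 : Matrix (Fin d) (Fin d) ℝ)).PosSemidef :=
    Matrix.PosSemidef.one.smul (by positivity)
  have h := (measurePreserving_eval_multivariateGaussian (μ := 0) hS (i := i)).map_eq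
  refine h.trans ?_
  congr 1
  ext
  simp

end Gaussian

/-! ### Polar decomposition and the radial moments of the Gaussian -/

section Polar

variable {d : ℕ} {lam : Measure ℝ} {μ : Measure (EuclideanSpace ℝ (Fin d))}
  [IsProbabilityMeasure μ]

lemma IsSphereMarginal.integral_inner (hlam : IsSphereMarginal d lam) {k : ℝ → ℝ}
    (hk : Continuous k) (x : EuclideanSpace ℝ (Fin d)) :
    ∫ ξ, k (inner ℝ x ξ) ∂(uniformSphere d) = ∫ u, k (‖x‖ * u) ∂lam := by
  rw [← integral_map (φ := fun ξ => inner ℝ x ξ) (f := k) (by fun_prop)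
    hk.aestronglyMeasurable, hlam.map_inner, integral_map (by fun_prop) hk.aestronglyMeasurable]

/-- The direction of a vector with an isometry invariant law is uniform. -/
lemma IsSphereMarginal.integral_norm_inner (hlam : IsSphereMarginal d lam) (hd : 1 ≤ d)
    (hμ : IsometryInvariant μ) (hmom : HasNormMoments μ) {K : ℝ → ℝ → ℝ}
    (hK : Continuous fun z : ℝ × ℝ => K z.1 z.2) (x : EuclideanSpace ℝ (Fin d)) {C : ℝ} {m : ℕ}
    (hKC : ∀ r y, 0 ≤ r → |y| ≤ ‖x‖ * r → |K r y| ≤ C * (1 + r) ^ m) :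
    ∫ g, K ‖g‖ (inner ℝ x g) ∂μ = ∫ g, ∫ u, K ‖g‖ (‖x‖ * ‖g‖ * u) ∂lam ∂μ := by
  have := isProbabilityMeasure_uniformSphere hd
  have hcont : Continuous fun z : EuclideanSpace ℝ (Fin d) × EuclideanSpace ℝ (Fin d) =>
      K ‖z.1‖ (inner ℝ (‖x‖ • z.2) z.1) :=
    hK.comp (f := fun z : EuclideanSpace ℝ (Fin d) × EuclideanSpace ℝ (Fin d) =>
      (‖z.1‖, inner ℝ (‖x‖ • z.2) z.1)) (by fun_prop)
  have hint : Integrable (fun z : EuclideanSpace ℝ (Fin d) × EuclideanSpace ℝ (Fin d) =>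
      K ‖z.1‖ (inner ℝ (‖x‖ • z.2) z.1)) (μ.prod (uniformSphere d)) := by
    refine hmom.integrable_prod_of_le (hasNormMoments_uniformSphere hd) (C := |C|) (m := m)
      hcont.aestronglyMeasurable ?_
    have h1 : ∀ᵐ z ∂(μ.prod (uniformSphere d)), ‖z.2‖ = 1 :=
      Measure.quasiMeasurePreserving_snd.ae ae_norm_eq_one_uniformSphere
    filter_upwards [h1] with z hz
    refine (hKC ‖z.1‖ _ (norm_nonneg _) ?_).trans ?_
    · refine (abs_real_inner_le_norm _ _).trans ?_
      rw [norm_smul, hz]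
      simp
    · have := norm_nonneg z.1
      refine mul_le_mul (le_abs_self C) (pow_le_pow_left₀ (by positivity) ?_ m)
        (by positivity) (abs_nonneg C)
      linarith [norm_nonneg z.2]
  -- An isometry takes x to ‖x‖ξ for every unit ξ, so the integral may be averaged over ξ. After
  -- Fubini, the inner integral for fixed g is one against the sphere marginal.
  have hconst : ∀ᵐ ξ ∂(uniformSphere d), ∫ g, K ‖g‖ (inner ℝ (‖x‖ • ξ) g) ∂μ =
      ∫ g, K ‖g‖ (inner ℝ x g) ∂μ := by
    filter_upwards [ae_norm_eq_one_uniformSphere] with ξ hξ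
    obtain ⟨L, hL⟩ := exists_isometry_map (x := x) (y := ‖x‖ • ξ) (by simp [norm_smul, hξ])
    rw [← hμ.integral_comp L fun g => K ‖g‖ (inner ℝ (‖x‖ • ξ) g)]
    congr 1
    ext g
    rw [← hL, L.inner_map_map, L.norm_map]
  have h1 : ∫ ξ, ∫ g, K ‖g‖ (inner ℝ (‖x‖ • ξ) g) ∂μ ∂(uniformSphere d) =
      ∫ g, K ‖g‖ (inner ℝ x g) ∂μ := by
    rw [integral_congr_ae hconst]
    simp
  rw [← h1, ← integral_integral_swap hint]
  congr 1
  ext g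
  have h2 : ∀ ξ : EuclideanSpace ℝ (Fin d),
      inner ℝ (‖x‖ • ξ) g = inner ℝ (‖x‖ • g) ξ := by
    intro ξ
    rw [real_inner_smul_left, real_inner_smul_left, real_inner_comm]
  simp_rw [h2]
  rw [hlam.integral_inner (k := fun y => K ‖g‖ y)
    (hK.comp (f := fun y : ℝ => (‖g‖, y)) (by fun_prop))]
  simp [norm_smul]

lemma IsSphereMarginal.integral_pow_add_two (hlam : IsSphereMarginal d lam) (k : ℕ) :
    ((d : ℝ) + k) * ∫ u, u ^ (k + 2) ∂lam = (k + 1) * ∫ u, u ^ k ∂lam := by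
  have hi : ∀ j : ℕ, Integrable (fun u => u ^ j) lam :=
    fun j => hlam.integrable_of_continuousOn (by fun_prop)
  have h := hlam.integral_id_mul (fun u => u ^ (k + 1)) (fun u => ((k : ℝ) + 1) * u ^ k)
    (fun u _ => by simpa using hasDerivAt_pow (k + 1) u) (by fun_prop)
  have e1 : ∀ u : ℝ, u * u ^ (k + 1) = u ^ (k + 2) := fun u => by ring
  have e2 : ∀ u : ℝ, (1 - u ^ 2) * (((k : ℝ) + 1) * u ^ k) =
      (k + 1) * (u ^ k - u ^ (k + 2)) := fun u => by ring
  simp_rw [e1, e2] at h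
  rw [integral_const_mul, integral_sub (hi _) (hi _)] at h
  linarith

lemma IsSphereMarginal.integral_even_pow_pos (hlam : IsSphereMarginal d lam) (hd : 1 ≤ d) (k : ℕ) :
    0 < ∫ u, u ^ (2 * k) ∂lam := by
  induction k with
  | zero =>
    have := hlam.isProbabilityMeasure
    simp
  | succ k ih =>
    have h := hlam.integral_pow_add_two (2 * k)
    have hd' : (1 : ℝ) ≤ d := by exact_mod_cast hd
    have h2 : 0 < ((d : ℝ) + (2 * k : ℕ)) * ∫ u, u ^ (2 * k + 2) ∂lam := by
      rw [h]
      positivity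
    exact pos_of_mul_pos_right h2 (by positivity)

/-- Polar decomposition of one coordinate factors its 2k-th moment as E‖G‖^(2k) E U^(2k). From k to
k+1 the left side is multiplied by (2k+1)/d and E U^(2k) by (2k+1)/(d+2k); the quotient is 1 + 2k/d.
-/
lemma integral_norm_pow_gaussianNormalized_succ (hd : 2 ≤ d) (k : ℕ) :
    ∫ g, ‖g‖ ^ (2 * (k + 1)) ∂(gaussianNormalized d) =
      (1 + 2 * k / d) * ∫ g, ‖g‖ ^ (2 * k) ∂(gaussianNormalized d) := by
  obtain ⟨lam, hlam⟩ := exists_isSphereMarginal hd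
  let i : Fin d := ⟨0, by omega⟩
  have hpolar : ∀ k : ℕ, ∫ x, x ^ (2 * k) ∂(gaussianReal 0 (1 / (d : NNReal))) =
      (∫ g, ‖g‖ ^ (2 * k) ∂(gaussianNormalized d)) * ∫ u, u ^ (2 * k) ∂lam := by
    intro k
    have h := hlam.integral_norm_inner (by omega) (isometryInvariant_gaussianNormalized (d := d))
      hasNormMoments_gaussianNormalized (K := fun _ y => y ^ (2 * k)) (by fun_prop)
      (EuclideanSpace.single i 1) (C := 1) (m := 2 * k) (fun r y hr hy => by
        have hy' : |y| ≤ 1 + r := by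
          refine hy.trans ?_
          simp
        rw [abs_pow, one_mul]
        gcongr)
    rw [← gaussianNormalized_map_eval i, integral_map (by fun_prop) (by fun_prop),
      ← integral_mul_const]
    simp only [EuclideanSpace.inner_single_left, map_one, one_mul, PiLp.norm_single,
      norm_one, mul_pow] at h
    rw [h]
    simp_rw [integral_const_mul]
  have h1 := hpolar k
  have h2 := hpolar (k + 1)
  have h3 := integral_pow_add_two_gaussianReal (1 / (d : NNReal)) (2 * k)
  have h4 := hlam.integral_pow_add_two (2 * k)
  have h5 := hlam.integral_even_pow_pos (by omega) k
  rw [show 2 * (k + 1) = 2 * k + 2 by ring] at h2 ⊢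
  rw [h2, h1] at h3
  have hd' : (0 : ℝ) < d := by exact_mod_cast (by omega : 0 < d)
  push_cast at h3 h4
  set U := ∫ u, u ^ (2 * k) ∂lam
  set U' := ∫ u, u ^ (2 * k + 2) ∂lam
  set R := ∫ g, ‖g‖ ^ (2 * k) ∂(gaussianNormalized d)
  set R' := ∫ g, ‖g‖ ^ (2 * k + 2) ∂(gaussianNormalized d)
  have h6 : U' = (2 * k + 1) * U / (d + 2 * k) := by
    rw [eq_div_iff (by positivity)]
    linarith
  rw [h6] at h3
  field_simp at h3 ⊢
  linarith

lemma integral_norm_pow_gaussianNormalized (hd : 2 ≤ d) (k : ℕ) :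
    ∫ g, ‖g‖ ^ (2 * k) ∂(gaussianNormalized d) =
      ∏ j ∈ Finset.range k, (1 + 2 * (j : ℝ) / d) := by
  induction k with
  | zero => simp
  | succ k ih => rw [integral_norm_pow_gaussianNormalized_succ hd, ih, Finset.prod_range_succ]; ring

end Polar

/-! ### Hybrid laws and their stability under convolution -/

section HybridLaw

variable {d : ℕ} {lam : Measure ℝ} {μ ν : Measure (EuclideanSpace ℝ (Fin d))} {m m' : ℝ}

/-- The laws of partial sums of independent spherical and Gaussian vectors with second moment
`m`, through the only properties that matter. -/
structure IsHybridLaw (μ : Measure (EuclideanSpace ℝ (Fin d))) (m : ℝ) : Prop where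
  isProbabilityMeasure : IsProbabilityMeasure μ
  map_neg : μ.map (fun x => -x) = μ
  hasNormMoments : HasNormMoments μ
  integral_sq : ∫ x, ‖x‖ ^ 2 ∂μ = m
  integral_four_le : ∫ x, ‖x‖ ^ 4 ∂μ ≤ 3 * m ^ 2

lemma HasNormMoments.integrable_rpow (hμ : HasNormMoments μ) [IsProbabilityMeasure μ] {p : ℝ}
    (hp : 0 ≤ p) : Integrable (fun x => ‖x‖ ^ p) μ := by
  refine hμ.integrable_of_le (C := 1) (m := ⌈p⌉₊)
    (Continuous.aestronglyMeasurable (continuous_norm.rpow_const fun _ => Or.inr hp))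
    (Eventually.of_forall fun x => ?_)
  have hx := norm_nonneg x
  rw [abs_of_nonneg (Real.rpow_nonneg hx p), one_mul, ← Real.rpow_natCast]
  calc ‖x‖ ^ p ≤ (1 + ‖x‖) ^ p := Real.rpow_le_rpow hx (by linarith) hp
    _ ≤ (1 + ‖x‖) ^ (⌈p⌉₊ : ℝ) :=
      Real.rpow_le_rpow_of_exponent_le (by linarith) (Nat.le_ceil p)

lemma IsometryInvariant.map_neg (hμ : IsometryInvariant μ) : μ.map (fun x => -x) = μ :=
  hμ (LinearIsometryEquiv.neg ℝ)

lemma isHybridLaw_map_smul [IsProbabilityMeasure μ] (hμ : IsometryInvariant μ)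
    (hmom : HasNormMoments μ) (h2 : ∫ x, ‖x‖ ^ 2 ∂μ = 1) (h4 : ∫ x, ‖x‖ ^ 4 ∂μ ≤ 3) (a : ℝ) :
    IsHybridLaw (μ.map fun x => a • x) (a ^ 2) where
  isProbabilityMeasure := Measure.isProbabilityMeasure_map (by fun_prop)
  map_neg := by
    rw [Measure.map_map (by fun_prop) (by fun_prop)]
    conv_rhs => rw [← hμ.map_neg]
    rw [Measure.map_map (by fun_prop) (by fun_prop)]
    congr 1
    ext x
    simp
  hasNormMoments := hmom.map_smul a
  integral_sq := by
    rw [integral_map (by fun_prop) (by fun_prop)]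
    simp only [norm_smul, mul_pow]
    rw [integral_const_mul, h2]
    simp
  integral_four_le := by
    rw [integral_map (by fun_prop) (by fun_prop)]
    simp only [norm_smul, mul_pow]
    rw [integral_const_mul, Real.norm_eq_abs, show |a| ^ 4 = (a ^ 2) ^ 2 by
      rw [← sq_abs a]; ring]
    nlinarith [sq_nonneg (a ^ 2)]

lemma isHybridLaw_uniformSphere_smul (hd : 2 ≤ d) (a : ℝ) :
    IsHybridLaw ((uniformSphere d).map fun x => a • x) (a ^ 2) := by
  have := isProbabilityMeasure_uniformSphere (d := d) (by omega)
  have h : ∀ k : ℕ, ∫ x, ‖x‖ ^ k ∂(uniformSphere d) = 1 := by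
    intro k
    have : ∫ x, ‖x‖ ^ k ∂(uniformSphere d) = ∫ x, 1 ∂(uniformSphere d) := by
      refine integral_congr_ae ?_
      filter_upwards [ae_norm_eq_one_uniformSphere] with x hx
      simp [hx]
    simpa using this
  exact isHybridLaw_map_smul uniformSphere_map_isometry
    (hasNormMoments_uniformSphere (by omega)) (h 2) (by rw [h 4]; norm_num) a

lemma isHybridLaw_gaussianNormalized_smul (hd : 2 ≤ d) (a : ℝ) :
    IsHybridLaw ((gaussianNormalized d).map fun x => a • x) (a ^ 2) := by
  have h2 := integral_norm_pow_gaussianNormalized hd 1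
  have h4 := integral_norm_pow_gaussianNormalized hd 2
  refine isHybridLaw_map_smul isometryInvariant_gaussianNormalized
    hasNormMoments_gaussianNormalized (by simpa using h2) ?_ a
  have hd' : (2 : ℝ) ≤ d := by exact_mod_cast hd
  have : (2 : ℝ) / d ≤ 1 := by rw [div_le_one (by linarith)]; exact hd'
  simp only [Finset.prod_range_succ, Finset.prod_range_zero] at h4
  norm_num at h4
  rw [h4]
  linarith

lemma isHybridLaw_dirac : IsHybridLaw (Measure.dirac (0 : EuclideanSpace ℝ (Fin d))) 0 where
  isProbabilityMeasure := inferInstance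
  map_neg := by rw [Measure.map_dirac' (by fun_prop)]; simp
  hasNormMoments := fun m => integrable_dirac (by simp)
  integral_sq := by simp
  integral_four_le := by simp

lemma integral_eq_half_add_neg (hν : ν.map (fun x => -x) = ν) {f : EuclideanSpace ℝ (Fin d) → ℝ}
    (hf : Integrable f ν) : ∫ x, f x ∂ν = ∫ x, (f x + f (-x)) / 2 ∂ν := by
  have h1 : ∫ x, f (-x) ∂ν = ∫ x, f x ∂ν := by
    conv_rhs => rw [← hν]
    exact (integral_map_equiv (MeasurableEquiv.neg _) f).symm
  have h2 : Integrable (fun x => f (-x)) ν := by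
    rw [← hν] at hf
    exact (integrable_map_equiv (MeasurableEquiv.neg _) f).1 hf
  rw [integral_div, integral_add hf h2, h1]
  ring

/-- Symmetry of ν cancels the terms of odd degree in y. For the fourth moment, Cauchy–Schwarz leaves
‖x‖⁴ + 6‖x‖²‖y‖² + ‖y‖⁴, and 3m² + 6mm' + 3m'² = 3(m + m')². -/
lemma IsHybridLaw.conv (hμ : IsHybridLaw μ m) (hν : IsHybridLaw ν m') :
    IsHybridLaw (μ ∗ ν) (m + m') := by
  have := hμ.isProbabilityMeasure
  have := hν.isProbabilityMeasure
  have hmom := hμ.hasNormMoments.conv hν.hasNormMoments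
  have hi : ∀ x : EuclideanSpace ℝ (Fin d), ∀ k : ℕ, Integrable (fun y => ‖x + y‖ ^ k) ν := by
    intro x k
    refine hν.hasNormMoments.integrable_of_le (C := (1 + ‖x‖) ^ k) (m := k) (by fun_prop)
      (Eventually.of_forall fun y => ?_)
    rw [abs_pow, abs_norm, ← mul_pow]
    gcongr
    nlinarith [norm_add_le x y, mul_nonneg (norm_nonneg x) (norm_nonneg y)]
  have hadd : ∀ x y : EuclideanSpace ℝ (Fin d), ‖x + y‖ ^ 2 = ‖x‖ ^ 2 + ‖y‖ ^ 2 + 2 * inner ℝ x y :=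
    fun x y => by rw [norm_add_sq_real]; ring
  have hsub : ∀ x y : EuclideanSpace ℝ (Fin d), ‖x + -y‖ ^ 2 = ‖x‖ ^ 2 + ‖y‖ ^ 2 - 2 * inner ℝ x y :=
    fun x y => by rw [hadd, norm_neg, inner_neg_right]; ring
  refine ⟨inferInstance, ?_, hmom, ?_, ?_⟩
  · have h := Measure.map_conv_addMonoidHom (μ := μ) (ν := ν)
      (-AddMonoidHom.id (EuclideanSpace ℝ (Fin d))) (by
        change Measurable fun x => -x
        fun_prop)
    refine h.trans ?_
    congr 1
    · exact hμ.map_neg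
    · exact hν.map_neg
  · rw [integral_conv (hmom 2)]
    have h1 : ∀ x, ∫ y, ‖x + y‖ ^ 2 ∂ν = ‖x‖ ^ 2 + m' := by
      intro x
      rw [integral_eq_half_add_neg hν.map_neg (hi x 2), ← hν.integral_sq]
      have : ∀ y, (‖x + y‖ ^ 2 + ‖x + -y‖ ^ 2) / 2 = ‖x‖ ^ 2 + ‖y‖ ^ 2 := by
        intro y
        rw [hadd, hsub]
        ring
      simp_rw [this]
      rw [integral_add (integrable_const _) (hν.hasNormMoments 2)]
      simp
    simp_rw [h1]
    rw [integral_add (hμ.hasNormMoments 2) (integrable_const _), hμ.integral_sq]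
    simp
  · rw [integral_conv (hmom 4)]
    have h1 : ∀ x, ∫ y, ‖x + y‖ ^ 4 ∂ν ≤ ‖x‖ ^ 4 + 6 * m' * ‖x‖ ^ 2 + 3 * m' ^ 2 := by
      intro x
      rw [integral_eq_half_add_neg hν.map_neg (hi x 4)]
      have hle : ∀ y, (‖x + y‖ ^ 4 + ‖x + -y‖ ^ 4) / 2 ≤
          ‖x‖ ^ 4 + 6 * ‖x‖ ^ 2 * ‖y‖ ^ 2 + ‖y‖ ^ 4 := by
        intro y
        have e1 : ‖x + y‖ ^ 4 = (‖x + y‖ ^ 2) ^ 2 := by ring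
        have e2 : ‖x + -y‖ ^ 4 = (‖x + -y‖ ^ 2) ^ 2 := by ring
        have e3 : (inner ℝ x y) ^ 2 ≤ (‖x‖ * ‖y‖) ^ 2 := by
          rw [← sq_abs]
          exact pow_le_pow_left₀ (abs_nonneg _) (abs_real_inner_le_norm x y) 2
        rw [e1, e2, hadd, hsub]
        nlinarith
      have hint : Integrable (fun y => ‖x‖ ^ 4 + 6 * ‖x‖ ^ 2 * ‖y‖ ^ 2) ν :=
        (integrable_const _).add ((hν.hasNormMoments 2).const_mul _)
      have h2 : ∫ y, (‖x + y‖ ^ 4 + ‖x + -y‖ ^ 4) / 2 ∂ν ≤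
          ∫ y, (‖x‖ ^ 4 + 6 * ‖x‖ ^ 2 * ‖y‖ ^ 2 + ‖y‖ ^ 4) ∂ν := by
        refine integral_mono_of_nonneg (Eventually.of_forall fun y => by positivity)
          (hint.add (hν.hasNormMoments 4)) (Eventually.of_forall hle)
      refine h2.trans ?_
      rw [integral_add hint (hν.hasNormMoments 4), integral_add (integrable_const _)
        ((hν.hasNormMoments 2).const_mul _), integral_const_mul, hν.integral_sq]
      simp only [integral_const, probReal_univ, smul_eq_mul, one_mul]
      linarith [hν.integral_four_le]
    have hint : Integrable (fun x => ‖x‖ ^ 4 + 6 * m' * ‖x‖ ^ 2) μ :=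
        (hμ.hasNormMoments 4).add ((hμ.hasNormMoments 2).const_mul _)
    have h2 : ∫ x, ∫ y, ‖x + y‖ ^ 4 ∂ν ∂μ ≤
        ∫ x, (‖x‖ ^ 4 + 6 * m' * ‖x‖ ^ 2 + 3 * m' ^ 2) ∂μ :=
      integral_mono_of_nonneg (Eventually.of_forall fun x => integral_nonneg fun y => by positivity)
        (hint.add (integrable_const _)) (Eventually.of_forall h1)
    refine h2.trans ?_
    rw [integral_add hint (integrable_const _), integral_add (hμ.hasNormMoments 4)
      ((hμ.hasNormMoments 2).const_mul _), integral_const_mul, hμ.integral_sq]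
    simp only [integral_const, probReal_univ, smul_eq_mul, one_mul]
    linarith [hμ.integral_four_le]

end HybridLaw

/-! ### Jensen's inequality in the squared radius -/

section Exchange

variable {d : ℕ} {lam : Measure ℝ} {μ ν : Measure (EuclideanSpace ℝ (Fin d))} {m q s : ℝ}

lemma IsSphereMarginal.continuous_sphMoment_zero (hlam : IsSphereMarginal d lam) (hq : 0 ≤ q) :
    Continuous (sphMoment lam s 0 0 q) := by
  have := hlam.isProbabilityMeasure
  have hc : Continuous fun z : ℝ × ℝ => z.2 ^ 0 * sphKernel s 0 z.1 z.2 ^ q :=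
    Continuous.mul (by fun_prop) (continuous_sphKernel.rpow_const fun _ => Or.inr hq)
  refine continuous_iff_continuousAt.2 fun t => ?_
  obtain ⟨C, hC⟩ := (isCompact_Icc.prod isCompact_Icc).exists_bound_of_continuousOn
    (hc.continuousOn (s := Icc (t - 1) (t + 1) ×ˢ Icc (-1 : ℝ) 1))
  refine tendsto_integral_filter_of_dominated_convergence (fun _ => C) ?_ ?_
    (integrable_const _) ?_
  · exact Eventually.of_forall fun e => (hc.comp (Continuous.prodMk_right e)).aestronglyMeasurable
  · filter_upwards [Icc_mem_nhds (sub_one_lt t) (lt_add_one t)] with e he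
    filter_upwards [hlam.ae_mem] with u hu
    exact hC (e, u) ⟨he, hu⟩
  · exact Eventually.of_forall fun u => (hc.comp (Continuous.prodMk_left u)).tendsto t

lemma sphKernel_zero_le {t u : ℝ} (hs : 0 ≤ s) (ht : 0 ≤ t) (hu : u ∈ Icc (-1 : ℝ) 1) :
    sphKernel s 0 t u ≤ (√s + √t) ^ 2 := by
  have h2 := Real.sq_sqrt hs
  have h3 := Real.sq_sqrt ht
  have h4 := mul_nonneg (Real.sqrt_nonneg s) (Real.sqrt_nonneg t)
  unfold sphKernel
  nlinarith [hu.2]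

lemma rpow_sq_le_pow_ceil {x r b : ℝ} (hq : 0 ≤ q) (hx : 0 ≤ x) (hr : 0 ≤ r) (hb : 0 ≤ b) {y : ℝ}
    (hy0 : 0 ≤ y) (hy : y ≤ (x + b * r) ^ 2) :
    y ^ q ≤ (1 + x + b) ^ (2 * q) * (1 + r) ^ ⌈2 * q⌉₊ := by
  have h1 : x + b * r ≤ (1 + x + b) * (1 + r) := by nlinarith [mul_nonneg hx hr, mul_nonneg hb hr]
  calc y ^ q ≤ ((x + b * r) ^ 2) ^ q := Real.rpow_le_rpow hy0 hy hq
    _ = (x + b * r) ^ (2 * q) := by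
      rw [← Real.rpow_natCast, ← Real.rpow_mul (by positivity)]
      norm_num
    _ ≤ ((1 + x + b) * (1 + r)) ^ (2 * q) := Real.rpow_le_rpow (by positivity) h1 (by linarith)
    _ = (1 + x + b) ^ (2 * q) * (1 + r) ^ (2 * q) :=
      Real.mul_rpow (by positivity) (by positivity)
    _ ≤ (1 + x + b) ^ (2 * q) * (1 + r) ^ ⌈2 * q⌉₊ := by
      gcongr
      rw [← Real.rpow_natCast]
      exact Real.rpow_le_rpow_of_exponent_le (by linarith) (Nat.le_ceil _)

lemma norm_add_rpow_eq (x y : EuclideanSpace ℝ (Fin d)) :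
    ‖x + y‖ ^ (2 * q) = (‖x‖ ^ 2 + ‖y‖ ^ 2 + 2 * inner ℝ x y) ^ q := by
  rw [Real.rpow_mul (norm_nonneg _)]
  congr 1
  rw [show (2 : ℝ) = (2 : ℕ) by norm_num, Real.rpow_natCast, norm_add_sq_real]
  push_cast
  ring

lemma IsSphereMarginal.integral_uniformSphere (hlam : IsSphereMarginal d lam) (hq : 0 ≤ q)
    (x : EuclideanSpace ℝ (Fin d)) (a : ℝ) :
    ∫ ξ, ‖x + a • ξ‖ ^ (2 * q) ∂(uniformSphere d) = sphMoment lam (‖x‖ ^ 2) 0 0 q (a ^ 2) := by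
  have h1 : ∫ ξ, ‖x + a • ξ‖ ^ (2 * q) ∂(uniformSphere d) =
      ∫ ξ, (‖x‖ ^ 2 + a ^ 2 + 2 * inner ℝ (a • x) ξ) ^ q ∂(uniformSphere d) := by
    refine integral_congr_ae ?_
    filter_upwards [ae_norm_eq_one_uniformSphere] with ξ hξ
    rw [norm_add_rpow_eq, norm_smul, hξ, real_inner_smul_left, real_inner_smul_right]
    simp
  rw [h1, hlam.integral_inner (k := fun y => (‖x‖ ^ 2 + a ^ 2 + 2 * y) ^ q)
    (Continuous.rpow_const (by fun_prop) fun _ => Or.inr hq)]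
  simp only [sphMoment, sphKernel, norm_smul, Real.sqrt_sq (norm_nonneg x), Real.sqrt_sq_eq_abs,
    Real.norm_eq_abs, pow_zero, one_mul, add_zero]
  congr 1
  ext u
  congr 1
  ring

lemma IsSphereMarginal.integral_invariant [IsProbabilityMeasure μ]
    (hlam : IsSphereMarginal d lam) (hd : 1 ≤ d) (hq : 0 ≤ q)
    (hμ : IsometryInvariant μ) (hmom : HasNormMoments μ) (x : EuclideanSpace ℝ (Fin d)) (a : ℝ) :
    ∫ g, ‖x + a • g‖ ^ (2 * q) ∂μ =
      ∫ g, sphMoment lam (‖x‖ ^ 2) 0 0 q (a ^ 2 * ‖g‖ ^ 2) ∂μ := by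
  have h1 : ∀ g, ‖x + a • g‖ ^ (2 * q) =
      (‖x‖ ^ 2 + a ^ 2 * ‖g‖ ^ 2 + 2 * inner ℝ (a • x) g) ^ q := by
    intro g
    rw [norm_add_rpow_eq, norm_smul, real_inner_smul_left, real_inner_smul_right, mul_pow]
    simp
  simp_rw [h1]
  rw [hlam.integral_norm_inner hd hμ hmom
    (K := fun r y => (‖x‖ ^ 2 + a ^ 2 * r ^ 2 + 2 * y) ^ q)
    (Continuous.rpow_const (by fun_prop) fun _ => Or.inr hq) (a • x)
    (C := (1 + ‖x‖ + |a|) ^ (2 * q)) (m := ⌈2 * q⌉₊) ?_]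
  · congr 1
    ext g
    simp only [sphMoment, sphKernel, norm_smul, Real.sqrt_sq (norm_nonneg x), pow_zero, one_mul,
      add_zero, ← mul_pow, Real.sqrt_sq_eq_abs, abs_mul, abs_norm, Real.norm_eq_abs]
    congr 1
    ext u
    congr 1
    ring
  · intro r y hr hy
    rw [norm_smul, Real.norm_eq_abs] at hy
    obtain ⟨h2, h3⟩ := abs_le.1 hy
    have h4 : 0 ≤ ‖x‖ ^ 2 + a ^ 2 * r ^ 2 + 2 * y := by
      rw [← sq_abs a]
      nlinarith [sq_nonneg (‖x‖ - |a| * r)]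
    rw [abs_of_nonneg (Real.rpow_nonneg h4 q)]
    refine rpow_sq_le_pow_ceil hq (norm_nonneg x) hr (abs_nonneg a) h4 ?_
    rw [← sq_abs a]
    nlinarith

lemma IsSphereMarginal.integrable_sphMoment_comp [IsProbabilityMeasure μ]
    (hlam : IsSphereMarginal d lam) (hq : 0 ≤ q)
    (hmom : HasNormMoments μ) (hs : 0 ≤ s) (a : ℝ) :
    Integrable (fun g => sphMoment lam s 0 0 q (a ^ 2 * ‖g‖ ^ 2)) μ := by
  have := hlam.isProbabilityMeasure
  refine hmom.integrable_of_le (C := (1 + √s + |a|) ^ (2 * q)) (m := ⌈2 * q⌉₊)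
    ((hlam.continuous_sphMoment_zero hq).comp (by fun_prop)).aestronglyMeasurable
    (Eventually.of_forall fun g => ?_)
  have ht : 0 ≤ a ^ 2 * ‖g‖ ^ 2 := by positivity
  have h := norm_integral_le_of_norm_le_const (μ := lam)
    (f := fun u => u ^ 0 * sphKernel s 0 (a ^ 2 * ‖g‖ ^ 2) u ^ q)
    (C := (1 + √s + |a|) ^ (2 * q) * (1 + ‖g‖) ^ ⌈2 * q⌉₊) (by
      filter_upwards [hlam.ae_mem] with u hu
      have h0 := le_sphKernel (e := 0) hs ht hu
      rw [pow_zero, one_mul, Real.norm_of_nonneg (Real.rpow_nonneg h0 q)]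
      refine rpow_sq_le_pow_ceil hq (Real.sqrt_nonneg s) (norm_nonneg g) (abs_nonneg a) h0 ?_
      refine (sphKernel_zero_le hs ht hu).trans_eq ?_
      rw [← mul_pow, Real.sqrt_sq_eq_abs, abs_mul, abs_norm])
  simpa [sphMoment] using h

/-- Jensen's inequality in the radial variable. -/
lemma IsSphereMarginal.add_integral_quarticAux_le (hlam : IsSphereMarginal d lam) (hd : 2 ≤ d)
    (hq : 0 ≤ q) {α β δ : ℝ} (hs : 0 ≤ s)
    (hconv : ConvexOn ℝ (Ici 0) fun t => sphMoment lam s 0 0 q t - quarticAux α β δ (s + t))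
    (a : ℝ) :
    sphMoment lam s 0 0 q (a ^ 2) + (α / 2 * (2 * a ^ 4 / d) +
      β / 6 * (3 * (s + a ^ 2) * (2 * a ^ 4 / d) + 8 * a ^ 6 / d ^ 2) +
      δ / 12 * (6 * (s + a ^ 2) ^ 2 * (2 * a ^ 4 / d) + 4 * (s + a ^ 2) * (8 * a ^ 6 / d ^ 2) +
        a ^ 8 * (12 / d ^ 2 + 48 / d ^ 3))) ≤
      ∫ g, sphMoment lam s 0 0 q (a ^ 2 * ‖g‖ ^ 2) ∂(gaussianNormalized d) := by
  have hmom := hasNormMoments_gaussianNormalized (d := d)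
  have hR := fun k => integral_norm_pow_gaussianNormalized hd k
  have h2 : ∫ g, ‖g‖ ^ 2 ∂(gaussianNormalized d) = 1 := by
    have := hR 1
    simpa using this
  have h4 : ∫ g, ‖g‖ ^ 4 ∂(gaussianNormalized d) = 1 + 2 / d := by
    have := hR 2
    simp only [Finset.prod_range_succ, Finset.prod_range_zero] at this
    norm_num at this
    exact this
  have h6 : ∫ g, ‖g‖ ^ 6 ∂(gaussianNormalized d) = (1 + 2 / d) * (1 + 4 / d) := by
    have := hR 3
    simp only [Finset.prod_range_succ, Finset.prod_range_zero] at this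
    norm_num at this
    exact this
  have h8 : ∫ g, ‖g‖ ^ 8 ∂(gaussianNormalized d) = (1 + 2 / d) * (1 + 4 / d) * (1 + 6 / d) := by
    have := hR 4
    simp only [Finset.prod_range_succ, Finset.prod_range_zero] at this
    norm_num at this
    exact this
  set N : ℝ → ℝ := fun t => sphMoment lam s 0 0 q t - quarticAux α β δ (s + t) with hN
  have hNc : Continuous N := by
    refine (hlam.continuous_sphMoment_zero hq).sub ?_
    unfold quarticAux
    fun_prop
  -- The numbers c0, …, c4 are the Taylor coefficients of the quartic at s.
  obtain ⟨c0, hc0⟩ : ∃ c, c = quarticAux α β δ s := ⟨_, rfl⟩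
  obtain ⟨c1, hc1⟩ : ∃ c, c = α * s + β * s ^ 2 / 2 + δ * s ^ 3 / 3 := ⟨_, rfl⟩
  obtain ⟨c2, hc2⟩ : ∃ c, c = α / 2 + β * s / 2 + δ * s ^ 2 / 2 := ⟨_, rfl⟩
  obtain ⟨c3, hc3⟩ : ∃ c, c = β / 6 + δ * s / 3 := ⟨_, rfl⟩
  obtain ⟨c4, hc4⟩ : ∃ c, c = δ / 12 := ⟨_, rfl⟩
  have hexp : ∀ r : ℝ, quarticAux α β δ (s + a ^ 2 * r ^ 2) =
      c0 + c1 * a ^ 2 * r ^ 2 + c2 * a ^ 4 * r ^ 4 + c3 * a ^ 6 * r ^ 6 + c4 * a ^ 8 * r ^ 8 := by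
    intro r
    rw [hc0, hc1, hc2, hc3, hc4]
    unfold quarticAux
    ring
  have i1 : Integrable (fun g : EuclideanSpace ℝ (Fin d) => c0 + c1 * a ^ 2 * ‖g‖ ^ 2)
      (gaussianNormalized d) := (integrable_const _).add ((hmom 2).const_mul _)
  have i2 : Integrable (fun g : EuclideanSpace ℝ (Fin d) => c0 + c1 * a ^ 2 * ‖g‖ ^ 2 +
      c2 * a ^ 4 * ‖g‖ ^ 4) (gaussianNormalized d) := i1.add ((hmom 4).const_mul _)
  have i3 : Integrable (fun g : EuclideanSpace ℝ (Fin d) => c0 + c1 * a ^ 2 * ‖g‖ ^ 2 +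
      c2 * a ^ 4 * ‖g‖ ^ 4 + c3 * a ^ 6 * ‖g‖ ^ 6) (gaussianNormalized d) :=
    i2.add ((hmom 6).const_mul _)
  have i4 : Integrable (fun g : EuclideanSpace ℝ (Fin d) => c0 + c1 * a ^ 2 * ‖g‖ ^ 2 +
      c2 * a ^ 4 * ‖g‖ ^ 4 + c3 * a ^ 6 * ‖g‖ ^ 6 + c4 * a ^ 8 * ‖g‖ ^ 8) (gaussianNormalized d) :=
    i3.add ((hmom 8).const_mul _)
  have hP : ∫ g, quarticAux α β δ (s + a ^ 2 * ‖g‖ ^ 2) ∂(gaussianNormalized d) =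
      c0 + c1 * a ^ 2 + c2 * a ^ 4 * (1 + 2 / d) + c3 * a ^ 6 * ((1 + 2 / d) * (1 + 4 / d)) +
        c4 * a ^ 8 * ((1 + 2 / d) * (1 + 4 / d) * (1 + 6 / d)) := by
    simp_rw [hexp]
    rw [integral_add i3 ((hmom 8).const_mul _), integral_add i2 ((hmom 6).const_mul _),
      integral_add i1 ((hmom 4).const_mul _), integral_add (integrable_const _)
      ((hmom 2).const_mul _), integral_const_mul, integral_const_mul, integral_const_mul,
      integral_const_mul, h2, h4, h6, h8]
    simp
  have hPi : Integrable (fun g => quarticAux α β δ (s + a ^ 2 * ‖g‖ ^ 2))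
      (gaussianNormalized d) := by
    simp_rw [hexp]
    exact i4
  have hMi := hlam.integrable_sphMoment_comp hq hmom hs a
  have hJ := hconv.map_integral_le (μ := gaussianNormalized d)
    (f := fun g => a ^ 2 * ‖g‖ ^ 2) hNc.continuousOn isClosed_Ici
    (Eventually.of_forall fun g => by
      change 0 ≤ a ^ 2 * ‖g‖ ^ 2
      positivity)
    ((hmom 2).const_mul _) (hMi.sub hPi)
  rw [integral_const_mul, h2, mul_one, integral_sub hMi hPi, hP] at hJ
  simp only [hN] at hJ
  have hx := hexp 1
  simp only [one_pow, mul_one] at hx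
  rw [hx] at hJ
  have hd0 : (d : ℝ) ≠ 0 := by
    have : (2 : ℝ) ≤ d := by exact_mod_cast hd
    positivity
  -- The gap is rewritten through Taylor expansion at the mean s + a²: 2/d, 8/d² and 12/d² + 48/d³
  -- are the second, third and fourth central moments of ‖G‖².
  have key : α / 2 * (2 * a ^ 4 / d) +
      β / 6 * (3 * (s + a ^ 2) * (2 * a ^ 4 / d) + 8 * a ^ 6 / d ^ 2) +
      δ / 12 * (6 * (s + a ^ 2) ^ 2 * (2 * a ^ 4 / d) + 4 * (s + a ^ 2) * (8 * a ^ 6 / d ^ 2) +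
        a ^ 8 * (12 / d ^ 2 + 48 / d ^ 3)) =
      c2 * a ^ 4 * (1 + 2 / d) + c3 * a ^ 6 * ((1 + 2 / d) * (1 + 4 / d)) +
        c4 * a ^ 8 * ((1 + 2 / d) * (1 + 4 / d) * (1 + 6 / d)) -
        (c2 * a ^ 4 + c3 * a ^ 6 + c4 * a ^ 8) := by
    rw [hc2, hc3, hc4]
    field_simp
    ring
  rw [key]
  linarith

end Exchange

/-! ### Exchanging one summand -/

section ExchangeStep

variable {d : ℕ} {lam : Measure ℝ} {μ ν : Measure (EuclideanSpace ℝ (Fin d))} {m q s : ℝ}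

lemma integral_conv_map_smul [IsProbabilityMeasure μ] [IsProbabilityMeasure ν]
    (hμ : HasNormMoments μ) (hν : HasNormMoments ν) (hq : 0 ≤ q) (a : ℝ) :
    Integrable (fun x => ∫ y, ‖x + a • y‖ ^ q ∂ν) μ ∧
    ∫ z, ‖z‖ ^ q ∂(μ ∗ (ν.map fun x => a • x)) = ∫ x, ∫ y, ‖x + a • y‖ ^ q ∂ν ∂μ := by
  have : IsProbabilityMeasure (ν.map fun x => a • x) :=
    Measure.isProbabilityMeasure_map (by fun_prop)
  have hi := (hμ.conv (hν.map_smul a)).integrable_rpow hq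
  have hc : Continuous fun z : EuclideanSpace ℝ (Fin d) => ‖z‖ ^ q :=
    continuous_norm.rpow_const fun _ => Or.inr hq
  have h1 : ∀ x, ∫ y, ‖x + y‖ ^ q ∂(ν.map fun x => a • x) = ∫ y, ‖x + a • y‖ ^ q ∂ν := by
    intro x
    exact integral_map (φ := fun y => a • y) (f := fun y => ‖x + y‖ ^ q) (by fun_prop)
      (Continuous.aestronglyMeasurable (hc.comp (continuous_const_add x)))
  constructor
  · rw [Measure.conv, integrable_map_measure hc.aestronglyMeasurable (by fun_prop)] at hi
    exact hi.integral_prod_left.congr (Eventually.of_forall h1)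
  · rw [integral_conv hi]
    simp_rw [h1]

/-- Replacing one spherical summand by a Gaussian one increases the moment. -/
lemma IsSphereMarginal.exchange (hlam : IsSphereMarginal d lam) (hd : 2 ≤ d) (hq : 0 ≤ q)
    {α β δ : ℝ} (hδ : δ ≤ 0)
    (hconv : ∀ s, 0 ≤ s →
      ConvexOn ℝ (Ici 0) fun t => sphMoment lam s 0 0 q t - quarticAux α β δ (s + t))
    {a : ℝ} (hμ : IsHybridLaw μ m) (hm : m + a ^ 2 = 1) :
    ∫ z, ‖z‖ ^ (2 * q) ∂(μ ∗ ((uniformSphere d).map fun x => a • x)) +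
      (α / 2 * (2 * a ^ 4 / d) +
      β / 6 * (3 * (2 * a ^ 4 / d) + 8 * a ^ 6 / d ^ 2) +
      δ / 12 * (18 * (2 * a ^ 4 / d) + 4 * (8 * a ^ 6 / d ^ 2) +
        a ^ 8 * (12 / d ^ 2 + 48 / d ^ 3))) ≤
      ∫ z, ‖z‖ ^ (2 * q) ∂(μ ∗ ((gaussianNormalized d).map fun x => a • x)) := by
  have := hμ.isProbabilityMeasure
  have := isProbabilityMeasure_uniformSphere (d := d) (by omega)
  obtain ⟨hFi, hF⟩ := integral_conv_map_smul hμ.hasNormMoments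
    (hasNormMoments_uniformSphere (by omega : 1 ≤ d)) (by linarith : 0 ≤ 2 * q) a
  obtain ⟨hGi, hG⟩ := integral_conv_map_smul hμ.hasNormMoments
    (hasNormMoments_gaussianNormalized (d := d)) (by linarith : 0 ≤ 2 * q) a
  rw [hF, hG]
  obtain ⟨v2, hv2⟩ : ∃ v, v = 2 * a ^ 4 / (d : ℝ) := ⟨_, rfl⟩
  obtain ⟨v3, hv3⟩ : ∃ v, v = 8 * a ^ 6 / (d : ℝ) ^ 2 := ⟨_, rfl⟩
  obtain ⟨v4, hv4⟩ : ∃ v, v = a ^ 8 * (12 / (d : ℝ) ^ 2 + 48 / (d : ℝ) ^ 3) := ⟨_, rfl⟩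
  have hv2nn : 0 ≤ v2 := by rw [hv2]; positivity
  have hpt : ∀ x : EuclideanSpace ℝ (Fin d),
      ∫ ξ, ‖x + a • ξ‖ ^ (2 * q) ∂(uniformSphere d) + (
        (α / 2 * v2 + β / 6 * (3 * a ^ 2 * v2 + v3) +
          δ / 12 * (6 * a ^ 4 * v2 + 4 * a ^ 2 * v3 + v4)) +
        (β / 2 * v2 + δ / 12 * (12 * a ^ 2 * v2 + 4 * v3)) * ‖x‖ ^ 2 +
        δ / 2 * v2 * ‖x‖ ^ 4) ≤
      ∫ g, ‖x + a • g‖ ^ (2 * q) ∂(gaussianNormalized d) := by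
    intro x
    rw [hlam.integral_uniformSphere hq, hlam.integral_invariant (by omega) hq
      isometryInvariant_gaussianNormalized hasNormMoments_gaussianNormalized]
    have h := hlam.add_integral_quarticAux_le hd hq (sq_nonneg ‖x‖) (hconv _ (sq_nonneg ‖x‖)) a
    rw [← hv2, ← hv3, ← hv4] at h
    refine le_trans (le_of_eq ?_) h
    ring
  have hi1 : Integrable (fun x : EuclideanSpace ℝ (Fin d) =>
      (α / 2 * v2 + β / 6 * (3 * a ^ 2 * v2 + v3) +
          δ / 12 * (6 * a ^ 4 * v2 + 4 * a ^ 2 * v3 + v4)) +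
        (β / 2 * v2 + δ / 12 * (12 * a ^ 2 * v2 + 4 * v3)) * ‖x‖ ^ 2) μ :=
    (integrable_const _).add ((hμ.hasNormMoments 2).const_mul _)
  have hi2 : Integrable (fun x : EuclideanSpace ℝ (Fin d) =>
      (α / 2 * v2 + β / 6 * (3 * a ^ 2 * v2 + v3) +
          δ / 12 * (6 * a ^ 4 * v2 + 4 * a ^ 2 * v3 + v4)) +
        (β / 2 * v2 + δ / 12 * (12 * a ^ 2 * v2 + 4 * v3)) * ‖x‖ ^ 2 +
        δ / 2 * v2 * ‖x‖ ^ 4) μ :=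
    hi1.add ((hμ.hasNormMoments 4).const_mul _)
  have hint := integral_mono (hFi.add hi2) hGi hpt
  simp only [Pi.add_apply] at hint
  rw [integral_add hFi hi2, integral_add hi1 ((hμ.hasNormMoments 4).const_mul _),
    integral_add (integrable_const _) ((hμ.hasNormMoments 2).const_mul _), integral_const_mul,
    integral_const_mul, hμ.integral_sq] at hint
  simp only [integral_const, probReal_univ, smul_eq_mul, one_mul] at hint
  refine le_trans (add_le_add_right ?_ _) hint
  rw [← hv2, ← hv3, ← hv4]
  have hm0 : 0 ≤ m := by
    rw [← hμ.integral_sq]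
    exact integral_nonneg fun x => by positivity
  have hm' : m = 1 - a ^ 2 := by linarith
  -- The left side is the mean of (‖x‖² + a²)², at most 3(m + a²)² = 3. It multiplies δ ≤ 0, so an
  -- upper bound is what is needed; the mean of ‖x‖² + a² is exactly 1.
  have h4 : ∫ x, ‖x‖ ^ 4 ∂μ + 2 * a ^ 2 * m + a ^ 4 ≤ 3 := by
    have := hμ.integral_four_le
    nlinarith [sq_nonneg a]
  have h5 := mul_le_mul_of_nonneg_left h4 (mul_nonneg (neg_nonneg.2 hδ) hv2nn)
  subst hm'
  nlinarith [h5]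

end ExchangeStep

/-! ### Numerical inequalities for the constants -/

section Constants

variable {d : ℕ} {q : ℝ}

/-- Reduces the range p > 4 to a constant free of d. Equality holds at q = 2; with d = 2 + e the
cleared difference is q - 2 times a polynomial in e with nonnegative coefficients. -/
lemma kappa_le (hq : 2 ≤ q) (hd : 2 ≤ d) :
    (2 * q + d - 2) * (2 * q + d - 4) / ((d : ℝ) * (d + 2)) ≤ q * (q - 1) / 2 := by
  have hd' : (2 : ℝ) ≤ d := by exact_mod_cast hd
  obtain ⟨e, he⟩ : ∃ e : ℝ, (d : ℝ) = 2 + e := ⟨d - 2, by ring⟩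
  have he0 : 0 ≤ e := by linarith
  rw [div_le_iff₀ (by positivity), he]
  have h1 : 0 ≤ (q - 2) * ((3 * q - 1) * e + (q + 1) * e ^ 2 / 2) := by
    have h2 : 0 ≤ q - 2 := by linarith
    have h3 : 0 ≤ 3 * q - 1 := by linarith
    have h4 : 0 ≤ q + 1 := by linarith
    positivity
  nlinarith [h1]

/-- Relative to the variance 2a⁴/d of a²‖G‖², the third and fourth central moments carry the factors
4a²/d and a⁴(6/d + 24/d²), at most 2 and 9 when a² ≤ 1 and d ≥ 2. -/
lemma central_moments_bound (hd : 2 ≤ d) {a : ℝ} (ha : a ^ 2 ≤ 1) :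
    0 ≤ 8 * a ^ 6 / (d : ℝ) ^ 2 ∧ 8 * a ^ 6 / (d : ℝ) ^ 2 ≤ 2 * (2 * a ^ 4 / d) ∧
      a ^ 8 * (12 / (d : ℝ) ^ 2 + 48 / (d : ℝ) ^ 3) ≤ 9 * (2 * a ^ 4 / d) := by
  have hd' : (2 : ℝ) ≤ d := by exact_mod_cast hd
  have hd0 : (0 : ℝ) < d := by linarith
  obtain ⟨A, hA⟩ : ∃ A, A = a ^ 2 := ⟨_, rfl⟩
  obtain ⟨w, hw⟩ : ∃ w, w = 1 / (d : ℝ) := ⟨_, rfl⟩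
  have hA0 : 0 ≤ A := hA ▸ sq_nonneg a
  have hA1 : A ≤ 1 := hA ▸ ha
  have hw0 : 0 ≤ w := by rw [hw]; positivity
  have hw1 : w ≤ 1 / 2 := by rw [hw]; gcongr
  have hA2 : A ^ 2 ≤ 1 := by nlinarith
  have e1 : 8 * a ^ 6 / (d : ℝ) ^ 2 = 4 * (A * w) * (2 * (A ^ 2 * w)) := by
    rw [hA, hw]; field_simp; ring
  have e2 : 2 * a ^ 4 / (d : ℝ) = 2 * (A ^ 2 * w) := by
    rw [hA, hw]; field_simp
  have e3 : a ^ 8 * (12 / (d : ℝ) ^ 2 + 48 / (d : ℝ) ^ 3) =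
      A ^ 2 * (6 * w + 24 * w ^ 2) * (2 * (A ^ 2 * w)) := by
    rw [hA, hw]; field_simp; ring
  have hV : 0 ≤ 2 * (A ^ 2 * w) := by positivity
  rw [e1, e2, e3]
  refine ⟨by positivity, ?_, ?_⟩
  · refine mul_le_mul_of_nonneg_right ?_ hV
    nlinarith
  · refine mul_le_mul_of_nonneg_right ?_ hV
    have : 6 * w + 24 * w ^ 2 ≤ 9 := by nlinarith
    nlinarith [mul_nonneg hw0 hw0]

end Constants

/-! ### Assembly of the inequality -/

section Main

variable {d : ℕ} {μ : Measure (EuclideanSpace ℝ (Fin d))} {m q a : ℝ}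

lemma exchange_deficitConst (hd : 2 ≤ d) (hq : 1 ≤ q) (hμ : IsHybridLaw μ m)
    (hm : m + a ^ 2 = 1) :
    ∫ z, ‖z‖ ^ (2 * q) ∂(μ ∗ ((uniformSphere d).map fun x => a • x)) +
      deficitConst (2 * q) d * a ^ 4 ≤
      ∫ z, ‖z‖ ^ (2 * q) ∂(μ ∗ ((gaussianNormalized d).map fun x => a • x)) := by
  obtain ⟨lam, hlam⟩ := exists_isSphereMarginal hd
  have hd' : (2 : ℝ) ≤ d := by exact_mod_cast hd
  have hm0 : 0 ≤ m := by
    rw [← hμ.integral_sq]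
    exact integral_nonneg fun x => by positivity
  obtain ⟨b3, b3', b4⟩ := central_moments_bound hd (a := a) (by linarith)
  have hv2nn : 0 ≤ 2 * a ^ 4 / (d : ℝ) := by positivity
  have hv2 : a ^ 4 = 2 * a ^ 4 / (d : ℝ) * (d / 2) := by field_simp
  have hq1 : 0 ≤ q * (q - 1) := by nlinarith
  rcases le_or_gt q 2 with h2 | h2
  · obtain ⟨c, hc⟩ : ∃ c, c = (2 * q + d - 2) * (2 * q + d - 4) / ((d : ℝ) * (d + 2)) *
      (q * (q - 1)) := ⟨_, rfl⟩
    have hc0 : 0 ≤ c := by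
      have h3 : 0 ≤ 2 * q + d - 2 := by linarith
      have h4 : 0 ≤ 2 * q + d - 4 := by linarith
      rw [hc]
      positivity
    have h := hlam.exchange hd (by linarith : 0 ≤ q) le_rfl
      (fun s hs => hlam.convexOn_sphMoment_of_le_two hd hs hq h2 hc) hμ hm
    refine le_trans (add_le_add_right ?_ _) h
    -- With v = 2a⁴/d and third central moment w ≤ 2v, the gain is cv/2 - (c/24)(3v + w) ≥ 7cv/24,
    -- more than the cv/4 required.
    have hdc : deficitConst (2 * q) d * a ^ 4 = c / 4 * (2 * a ^ 4 / d) := by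
      rw [deficitConst, if_pos (by linarith), hc]
      field_simp
      ring
    rw [hdc]
    have h5 := mul_le_mul_of_nonneg_left b3' hc0
    have h6 := mul_nonneg hc0 hv2nn
    linarith
  · have hk := kappa_le h2.le hd
    have hdc : deficitConst (2 * q) d * a ^ 4 =
        (2 * q + d - 2) * (2 * q + d - 4) / ((d : ℝ) * (d + 2)) / 48 * (2 * a ^ 4 / d) := by
      rw [deficitConst, if_neg (by linarith)]
      field_simp
      ring
    have hdc' : deficitConst (2 * q) d * a ^ 4 ≤ q * (q - 1) / 96 * (2 * a ^ 4 / d) := by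
      rw [hdc]
      refine mul_le_mul_of_nonneg_right ?_ hv2nn
      linarith
    have h6 := mul_nonneg hq1 hv2nn
    have h5 := mul_le_mul_of_nonneg_left b3' hq1
    have h7 := mul_le_mul_of_nonneg_left b4 hq1
    have h8 := mul_nonneg hq1 b3
    -- The target is q(q-1)v/96 with v = 2a⁴/d. For q ≤ 3 the gain is at least q(q-1)v(1/8 -
    -- 27/384). For q > 3 it is at least q(q-1)v/2, after dropping the nonnegative third central
    -- moment.
    rcases le_or_gt q 3 with h3 | h3
    · have h := hlam.exchange hd (by linarith : 0 ≤ q)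
        (show -(q * (q - 1) / 32) ≤ 0 by linarith)
        (fun s hs => hlam.convexOn_sphMoment_of_le_three hd hs h2.le h3) hμ hm
      refine le_trans (add_le_add_right (hdc'.trans ?_) _) h
      linarith
    · have h := hlam.exchange hd (by linarith : 0 ≤ q) le_rfl
        (fun s hs => hlam.convexOn_sphMoment_of_three_le hd hs h3.le) hμ hm
      refine le_trans (add_le_add_right (hdc'.trans ?_) _) h
      have h9 := mul_nonneg (show 0 ≤ q - 2 by linarith) h8
      linarith

lemma map_finsetSum_insert {Ω ι : Type*} [MeasurableSpace Ω] [DecidableEq ι] {P : Measure Ω}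
    [IsProbabilityMeasure P] {ξ : ι → Ω → EuclideanSpace ℝ (Fin d)}
    (hlaw : ∀ j, HasLaw (ξ j) (uniformSphere d) P) (hind : iIndepFun ξ P) (a : ι → ℝ)
    {s : Finset ι} {i : ι} (hi : i ∉ s) :
    P.map (fun ω => ∑ j ∈ insert i s, a j • ξ j ω) =
      ((uniformSphere d).map fun x => a i • x) ∗ P.map (fun ω => ∑ j ∈ s, a j • ξ j ω) := by
  have hm : ∀ j, AEMeasurable (fun ω => a j • ξ j ω) P :=
    fun j => (hlaw j).aemeasurable.const_smul (a j)
  have hind' : iIndepFun (fun j ω => a j • ξ j ω) P :=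
    hind.comp (fun j x => a j • x) fun j => by fun_prop
  have h := (hind'.indepFun_finsetSum_of_notMem₀ hm hi).symm
  have hsm : AEMeasurable (∑ j ∈ s, fun ω => a j • ξ j ω) P :=
    Finset.aemeasurable_sum s fun j _ => hm j
  have h2 := h.map_add_eq_map_conv_map₀ (hm i) hsm
  have e1 : (fun ω => a i • ξ i ω) + ∑ j ∈ s, (fun ω => a j • ξ j ω) =
      fun ω => ∑ j ∈ insert i s, a j • ξ j ω := by
    ext1 ω
    rw [Finset.sum_insert hi, Pi.add_apply, Finset.sum_apply]
  have e2 : ∑ j ∈ s, (fun ω => a j • ξ j ω) = fun ω => ∑ j ∈ s, a j • ξ j ω := by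
    ext1 ω
    rw [Finset.sum_apply]
  have e3 : P.map (fun ω => a i • ξ i ω) = (uniformSphere d).map fun x => a i • x := by
    rw [← (hlaw i).map_eq, AEMeasurable.map_map_of_aemeasurable (by fun_prop) (hlaw i).aemeasurable]
    rfl
  rw [e1, e2, e3] at h2
  exact h2

lemma isHybridLaw_map_finsetSum {Ω ι : Type*} [MeasurableSpace Ω] {P : Measure Ω}
    [IsProbabilityMeasure P] {ξ : ι → Ω → EuclideanSpace ℝ (Fin d)} (hd : 2 ≤ d)
    (hlaw : ∀ j, HasLaw (ξ j) (uniformSphere d) P) (hind : iIndepFun ξ P) (a : ι → ℝ)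
    (s : Finset ι) :
    IsHybridLaw (P.map fun ω => ∑ j ∈ s, a j • ξ j ω) (∑ j ∈ s, a j ^ 2) := by
  classical
  induction s using Finset.induction_on with
  | empty => simpa using isHybridLaw_dirac
  | insert i s hi ih =>
    rw [map_finsetSum_insert hlaw hind a hi, Finset.sum_insert hi]
    exact (isHybridLaw_uniformSphere_smul hd (a i)).conv ih

/-- The induction must allow an arbitrary hybrid background μ, since each untreated spherical
summand is absorbed into it. -/
lemma integral_conv_map_finsetSum_add_le {Ω ι : Type*} [MeasurableSpace Ω] {P : Measure Ω}
    [IsProbabilityMeasure P] {ξ : ι → Ω → EuclideanSpace ℝ (Fin d)} (hd : 2 ≤ d) (hq : 1 ≤ q)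
    (hlaw : ∀ j, HasLaw (ξ j) (uniformSphere d) P) (hind : iIndepFun ξ P) (a : ι → ℝ)
    (s : Finset ι) : ∀ (μ : Measure (EuclideanSpace ℝ (Fin d))) (m b : ℝ), IsHybridLaw μ m →
      b ^ 2 = ∑ j ∈ s, a j ^ 2 → m + b ^ 2 = 1 →
      ∫ z, ‖z‖ ^ (2 * q) ∂(μ ∗ P.map fun ω => ∑ j ∈ s, a j • ξ j ω) +
        deficitConst (2 * q) d * ∑ j ∈ s, a j ^ 4 ≤
      ∫ z, ‖z‖ ^ (2 * q) ∂(μ ∗ ((gaussianNormalized d).map fun x => b • x)) := by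
  classical
  induction s using Finset.induction_on with
  | empty =>
    intro μ m b hμ hb hm
    have hb0 : b = 0 := by simpa using hb
    subst hb0
    simp
  | insert i s hi ih =>
    intro μ m b hμ hb hm
    have := hμ.isProbabilityMeasure
    have hν := isHybridLaw_uniformSphere_smul hd (a i)
    have := hν.isProbabilityMeasure
    have hS := isHybridLaw_map_finsetSum hd hlaw hind a s
    have := hS.isProbabilityMeasure
    rw [Finset.sum_insert hi] at hb
    rw [map_finsetSum_insert hlaw hind a hi, Finset.sum_insert hi, ← Measure.conv_assoc]
    obtain ⟨b', hb'⟩ : ∃ b' : ℝ, b' ^ 2 = ∑ j ∈ s, a j ^ 2 :=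
      ⟨√(∑ j ∈ s, a j ^ 2), Real.sq_sqrt (Finset.sum_nonneg fun j _ => sq_nonneg _)⟩
    have hγ := isHybridLaw_gaussianNormalized_smul hd b'
    have := hγ.isProbabilityMeasure
    -- Summand i stays spherical inside the background while the others become Gaussian. Then it is
    -- exchanged against the background μ plus that Gaussian block, and the two Gaussians merge.
    have h1 := ih _ _ b' (hμ.conv hν) hb' (by linarith)
    have h2 := exchange_deficitConst (a := a i) hd hq (hμ.conv hγ) (by linarith)
    have hγa := (isHybridLaw_gaussianNormalized_smul hd (a i)).isProbabilityMeasure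
    have e1 : (μ ∗ (uniformSphere d).map fun x => a i • x) ∗
        ((gaussianNormalized d).map fun x => b' • x) =
        (μ ∗ (gaussianNormalized d).map fun x => b' • x) ∗
        ((uniformSphere d).map fun x => a i • x) := by
      rw [Measure.conv_assoc, Measure.conv_comm ((uniformSphere d).map _), ← Measure.conv_assoc]
    have e2 : (μ ∗ (gaussianNormalized d).map fun x => b' • x) ∗
        ((gaussianNormalized d).map fun x => a i • x) =
        μ ∗ ((gaussianNormalized d).map fun x => b • x) := by
      rw [Measure.conv_assoc, gaussianNormalized_map_smul_conv b' (a i) b (by linarith)]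
    rw [e1] at h1
    rw [e2] at h2
    rw [mul_add]
    linarith

lemma isDeficitConstant_deficitConst {p : ℝ} (hp : 2 ≤ p) (hd : 2 ≤ d) :
    IsDeficitConstant.{u} p d (deficitConst p d) := by
  intro Ω Ω' _ _ P _ P' _ n ξ Z hlaw hind hZ a ha
  have hS := isHybridLaw_map_finsetSum hd hlaw hind a Finset.univ
  have := hS.isProbabilityMeasure
  have hp0 : 0 ≤ p := by linarith
  have hc : Continuous fun z : EuclideanSpace ℝ (Fin d) => ‖z‖ ^ p :=
    continuous_norm.rpow_const fun _ => Or.inr hp0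
  have hm : AEMeasurable (fun ω => ∑ j, a j • ξ j ω) P :=
    Finset.aemeasurable_fun_sum _ fun j _ => (hlaw j).aemeasurable.const_smul (a j)
  refine ⟨?_, ?_, ?_⟩
  · have h := hS.hasNormMoments.integrable_rpow hp0
    rwa [integrable_map_measure hc.aestronglyMeasurable hm] at h
  · have h := (hasNormMoments_gaussianNormalized (d := d)).integrable_rpow hp0
    rwa [← hZ.map_eq, integrable_map_measure hc.aestronglyMeasurable hZ.aemeasurable] at h
  · have h := integral_conv_map_finsetSum_add_le (q := p / 2) hd (by linarith) hlaw hind a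
      Finset.univ (Measure.dirac 0) 0 1 isHybridLaw_dirac (by rw [ha]; norm_num) (by norm_num)
    rw [Measure.dirac_zero_conv, Measure.dirac_zero_conv, mul_div_cancel₀ _ two_ne_zero] at h
    simp only [one_smul, Measure.map_id'] at h
    rw [← hZ.map_eq, integral_map hm hc.aestronglyMeasurable,
      integral_map hZ.aemeasurable hc.aestronglyMeasurable] at h
    linarith

/-! ### The order 1/d and its optimality -/

lemma deficitConst_isTheta {p : ℝ} (hp : 2 < p) :
    (fun d : ℕ => deficitConst p d) =Θ[atTop] (fun d : ℕ => 1 / (d : ℝ)) := by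
  obtain ⟨k, hk⟩ : ∃ k, k = (if p ≤ 4 then 3 * p * (p - 2) else 1) := ⟨_, rfl⟩
  have hk0 : k ≠ 0 := by
    rw [hk]
    split_ifs
    · have : 0 < p - 2 := by linarith
      positivity
    · exact one_ne_zero
  have hw : Tendsto (fun d : ℕ => 1 / (d : ℝ)) atTop (𝓝 0) := tendsto_one_div_atTop_nhds_zero_nat
  have hlim : Tendsto (fun d : ℕ => (1 + (p - 2) * (1 / (d : ℝ))) * (1 + (p - 4) * (1 / (d : ℝ))) /
      (24 * (1 + 2 * (1 / (d : ℝ)))) * k) atTop (𝓝 (k / 24)) := by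
    have h1 := ((hw.const_mul (p - 2)).const_add 1).mul ((hw.const_mul (p - 4)).const_add 1)
    have h2 := ((hw.const_mul 2).const_add 1).const_mul 24
    have h3 := (h1.div h2 (by norm_num)).mul_const k
    have e : (1 + (p - 2) * 0) * (1 + (p - 4) * 0) / (24 * (1 + 2 * 0)) * k = k / 24 := by ring
    rw [e] at h3
    exact h3
  refine (Asymptotics.isTheta_of_div_tendsto_nhds_ne_zero (hlim.congr' ?_)
    (div_ne_zero hk0 (by norm_num))).symm
  filter_upwards [eventually_gt_atTop 0] with d hd
  have hd' : (0 : ℝ) < d := by exact_mod_cast hd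
  rw [deficitConst, ← hk]
  field_simp
  ring

/-- The product is a polynomial in y with nonnegative coefficients and constant term 1, and y^i ≤ y
for i ≥ 1 on [0, 1]. -/
lemma prod_one_add_mul_sub_one_le {y : ℝ} (hy : 0 ≤ y) (hy1 : y ≤ 1) (k : ℕ) :
    1 ≤ ∏ j ∈ Finset.range k, (1 + 2 * (j : ℝ) * y) ∧
    ∏ j ∈ Finset.range k, (1 + 2 * (j : ℝ) * y) - 1 ≤
      y * (∏ j ∈ Finset.range k, (1 + 2 * (j : ℝ)) - 1) := by
  induction k with
  | zero => simp
  | succ k ih =>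
    obtain ⟨h1, h2⟩ := ih
    rw [Finset.prod_range_succ, Finset.prod_range_succ]
    obtain ⟨A, hA⟩ : ∃ A, A = ∏ j ∈ Finset.range k, (1 + 2 * (j : ℝ) * y) := ⟨_, rfl⟩
    obtain ⟨B, hB⟩ : ∃ B, B = ∏ j ∈ Finset.range k, (1 + 2 * (j : ℝ)) := ⟨_, rfl⟩
    have hAB : A ≤ B := by
      rw [hA, hB]
      refine Finset.prod_le_prod (fun j _ => by positivity) fun j _ => ?_
      have : (0 : ℝ) ≤ j := j.cast_nonneg
      nlinarith
    rw [← hA] at h1 h2 ⊢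
    rw [← hB] at h2 ⊢
    have hk : (0 : ℝ) ≤ k := k.cast_nonneg
    have hky : 0 ≤ (k : ℝ) * y := mul_nonneg hk hy
    constructor
    · nlinarith
    · nlinarith [mul_le_mul_of_nonneg_left hAB hky]

/-- A single vector with coefficient 1 gives c ≤ E‖Z‖^p - 1. An even exponent 2k ≥ p has explicit
Gaussian moment ∏(1 + 2j/d), so K = ∏(1 + 2j) - 1 works. -/
lemma exists_le_div_of_isDeficitConstant {p : ℝ} (hp : 2 ≤ p) :
    ∃ K : ℝ, ∀ d : ℕ, 2 ≤ d → ∀ c : ℝ, IsDeficitConstant.{u} p d c → c ≤ K / d := by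
  obtain ⟨k, hk⟩ : ∃ k : ℕ, p ≤ 2 * k := by
    obtain ⟨k, hk⟩ := exists_nat_ge p
    exact ⟨k, by linarith [(k.cast_nonneg : (0 : ℝ) ≤ k)]⟩
  refine ⟨∏ j ∈ Finset.range k, (1 + 2 * (j : ℝ)) - 1, fun d hd c hc => ?_⟩
  have := isProbabilityMeasure_uniformSphere (d := d) (by omega)
  have : IsProbabilityMeasure (gaussianNormalized d) := by
    rw [gaussianNormalized]
    infer_instance
  -- The admissible sample spaces live in universe u, so the test vectors are realised on a lifted
  -- copy of the Euclidean space.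
  have hlaw : ∀ μ : Measure (EuclideanSpace ℝ (Fin d)),
      HasLaw ULift.down.{u} μ (μ.map ULift.up.{u}) := fun μ =>
    ⟨measurable_down.aemeasurable, by
      rw [Measure.map_map measurable_down measurable_up]
      exact Measure.map_id⟩
  have := Measure.isProbabilityMeasure_map (μ := uniformSphere d) measurable_up.{_, u}.aemeasurable
  have := Measure.isProbabilityMeasure_map (μ := gaussianNormalized d)
    measurable_up.{_, u}.aemeasurable
  obtain ⟨-, -, h⟩ := hc _ _ ((uniformSphere d).map ULift.up.{u})
    ((gaussianNormalized d).map ULift.up.{u}) 1 (fun _ => ULift.down) ULift.down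
    (fun _ => hlaw _) iIndepFun.of_subsingleton (hlaw _) (fun _ => 1) (by simp)
  have hp0 : 0 ≤ p := by linarith
  have hcont : Continuous fun z : EuclideanSpace ℝ (Fin d) => ‖z‖ ^ p :=
    continuous_norm.rpow_const fun _ => Or.inr hp0
  have hint : ∀ μ : Measure (EuclideanSpace ℝ (Fin d)),
      ∫ ω, ‖ω.down‖ ^ p ∂(μ.map ULift.up.{u}) = ∫ x, ‖x‖ ^ p ∂μ := fun μ =>
    integral_map measurable_up.aemeasurable
      (hcont.measurable.comp measurable_down).aestronglyMeasurable
  have hone : ∫ x, ‖x‖ ^ p ∂(uniformSphere d) = 1 := by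
    rw [integral_congr_ae (g := fun _ => (1 : ℝ))]
    · simp
    · filter_upwards [ae_norm_eq_one_uniformSphere (d := d)] with x hx
      rw [hx, Real.one_rpow]
  simp only [Finset.univ_unique, Finset.sum_const, Finset.card_singleton, one_smul, one_pow,
    mul_one] at h
  rw [hint, hint, hone] at h
  have hk0 : (0 : ℝ) < k := by linarith
  obtain ⟨t, ht⟩ : ∃ t, t = p / (2 * k) := ⟨_, rfl⟩
  have ht0 : 0 ≤ t := by rw [ht]; positivity
  have ht1 : t ≤ 1 := by rw [ht]; exact div_le_one_of_le₀ hk (by positivity)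
  -- Concavity of y ↦ y^t at y = 1, with t = p/(2k) ≤ 1 and y = ‖x‖^(2k).
  have hpt : ∀ x : EuclideanSpace ℝ (Fin d), ‖x‖ ^ p ≤ (1 - t) + t * ‖x‖ ^ (2 * k) := by
    intro x
    have h1 := rpow_one_add_le_one_add_mul_self (s := ‖x‖ ^ (2 * k) - 1)
      (by linarith [pow_nonneg (norm_nonneg x) (2 * k)]) ht0 ht1
    have e : (1 + (‖x‖ ^ (2 * k) - 1)) ^ t = ‖x‖ ^ p := by
      rw [add_sub_cancel, ← Real.rpow_natCast, ← Real.rpow_mul (norm_nonneg x), ht]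
      congr 1
      push_cast
      field_simp
    rw [e] at h1
    linarith
  have hM := hasNormMoments_gaussianNormalized (d := d)
  have hle := integral_mono (hM.integrable_rpow hp0)
    ((integrable_const (1 - t)).add ((hM (2 * k)).const_mul t)) hpt
  simp only [Pi.add_apply] at hle
  rw [integral_add (integrable_const _) ((hM (2 * k)).const_mul t), integral_const_mul,
    integral_norm_pow_gaussianNormalized (by omega)] at hle
  simp only [integral_const, probReal_univ, smul_eq_mul, one_mul] at hle
  have hd' : (2 : ℝ) ≤ d := by exact_mod_cast hd
  obtain ⟨h1, h2⟩ := prod_one_add_mul_sub_one_le (y := 1 / (d : ℝ)) (by positivity)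
    (by rw [div_le_one (by linarith)]; linarith) k
  simp only [mul_one_div] at h1 h2
  rw [one_div_mul_eq_div] at h2
  nlinarith [mul_nonneg (sub_nonneg.2 ht1) (sub_nonneg.2 h1)]

end Main

end

end

theorem theorem1 (p : ℝ) (hp : 2 ≤ p) :
    (∀ d : ℕ, 2 ≤ d → IsDeficitConstant.{u} p d (deficitConst p d)) ∧
    (2 < p → (fun d : ℕ => deficitConst p d) =Θ[Filter.atTop] (fun d : ℕ => 1 / (d : ℝ))) ∧
    (∃ K : ℝ, ∀ d : ℕ, 2 ≤ d → ∀ c : ℝ, IsDeficitConstant.{u} p d c → c ≤ K / d) :=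
  ⟨fun _ hd => isDeficitConstant_deficitConst hp hd, fun h => deficitConst_isTheta h,
    exists_le_div_of_isDeficitConstant hp⟩
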